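/- **Setting.** Consider a bandit with two arms in $\mathbb{R}^d$, $d\ge 1$. In rounds $t=1,2,\dots$ a context $(X_{t,1},X_{t,2})\in(\mathbb{R}^d)^2$ is drawn i.i.d. with Lebesgue density $p$, independently of the past; the agent pulls an arm $a_t$ and observes $Y_{t,a_t}$, where $Y_{t,i}=\mu(X_{t,i}^\top\beta^*)+\epsilon_{t,i}$ and, conditionally on the past and on the contexts (and the internal coin) of round $t$, the noise $\epsilon_{t,i}$ has mean zero and is sub-Gaussian with parameter $\sigma>0$. The expected regret is $\mathcal{R}(T)=\sum_{t=1}^T\mathbb{E}\big[\max_i\mu(X_{t,i}^\top\beta^*)-\mu(X_{t,a_t}^\top\beta^*)\big]$. Let $S_0=\{j:\beta^*_j\ne0\}$, $s_0=|S_0|$, and $\Sigma=\frac12\mathbb{E}[X_{t,1}X_{t,1}^\top+X_{t,2}X_{t,2}^\top]$. **Assumptions.** (i) $\|X_{t,i}\|_2\le x_{\max}$ almost surely and $\|\beta^*\|_2\le b$, with $x_{\max},b>0$. (ii) $\mu$ is differentiable with $0<\kappa_0\le\dot\mu\le\kappa_1<\infty$ on $\mathbb{R}$. (iii) $p(-\mathbf{x})\le\nu\,p(\mathbf{x})$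 for almost all $\mathbf{x}$, with $\nu<\infty$. (iv) Restricted eigenvalue condition: there is $\phi_1>0$ with $\phi_1^2\|\beta\|_2^2\le\beta^\top\Sigma\beta$ for every $\beta$ with $\sum_{j\notin S_0}|\beta_j|\le3\sum_{j\in S_0}|\beta_j|$. **Algorithm (SA Lasso Bandit, $\lambda_0=2\sigma x_{\max}$).** In round $t$ pull an arm $a_t$ that maximizes $X_{t,i}^\top\hat\beta_t$, a tie being decided by an independent fair coin. The first estimate $\hat\beta_1$ is arbitrary, and $\hat\beta_{t+1}$ is any minimizer (chosen measurably from the past) of $$-\frac1t\sum_{s=1}^t\big[Y_{s,a_s}X_{s,a_s}^\top\beta-m(X_{s,a_s}^\top\beta)\big]+\lambda_t\|\beta\|_1,\qquad \lambda_t=\lambda_0\sqrt{\frac{4\log t+2\log d}{t}},\qquad \dot m=\mu .$$ **Theorem.** The regret satisfies $\mathcal{R}(T)=O\big(\sqrt{s_0T\log(dT)}\big)$ as $T\to\infty$. Explicitly, for every $T\ge1$, $$\mathcal{R}(T)\le4\kappa_1+\frac{4\kappa_1x_{\max}b\,(\log(2d^2)+1)}{C_2^2}+\frac{48\,\kappa_1\nu\sigma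 x_{\max}^2\sqrt{s_0T\log(dT)}}{\kappa_0\phi_1^2},\qquad C_2=\min\Big(\frac12,\frac{\phi_1^2}{256\,s_0\nu x_{\max}^2}\Big).$$ In particular, if $x_{\max}\le1$, the factor $x_{\max}^2$ may be replaced by $x_{\max}$. -/

import Mathlib

open MeasureTheory ProbabilityTheory
open scoped Matrix

noncomputable section

namespace SparseBandit

/-- Feature vectors in `ℝ^d`, with the Euclidean norm and inner product. -/
abbrev Feature (d : ℕ) := EuclideanSpace ℝ (Fin d)

/-- A context of one round: one feature vector for each of the `K` arms. -/
abbrev Context (K d : ℕ) := Fin K → Feature d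

/-- The `ℓ₁` norm on `ℝ^d`. -/
def l1Norm {d : ℕ} (β : Feature d) : ℝ := ∑ j, |β j|

open Classical in
/-- The active set `S₀ = {j : β_j ≠ 0}`. -/
def activeSet {d : ℕ} (β : Feature d) : Finset (Fin d) :=
  Finset.univ.filter fun j => β j ≠ 0

/-- The cone `ℂ(S) = {β : ‖β_{Sᶜ}‖₁ ≤ 3 ‖β_S‖₁}`. -/
def cone {d : ℕ} (S : Finset (Fin d)) : Set (Feature d) :=
  {β | ∑ j ∈ Sᶜ, |β j| ≤ 3 * ∑ j ∈ S, |β j|}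

/-- The law on contexts with density `p` with respect to Lebesgue measure on `(ℝ^d)^K`. -/
def contextLaw {K d : ℕ} (p : Context K d → ℝ) : Measure (Context K d) :=
  volume.withDensity fun x => ENNReal.ofReal (p x)

/-- The theoretical Gram matrix `Σ = (1/K) 𝔼[𝐗ᵀ 𝐗]`, where the rows of `𝐗` are the
feature vectors of the `K` arms. -/
def gram {K d : ℕ} (Q : Measure (Context K d)) : Matrix (Fin d) (Fin d) ℝ :=
  Matrix.of fun i j => (1 / (K : ℝ)) * ∫ x, ∑ k, x k i * x k j ∂Q

/-- Restricted eigenvalue condition for the matrix `M` and the index set `S`: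
`φ² ‖β‖₂² ≤ βᵀ M β` for all `β` in the cone of `S`. -/
def RECondition {d : ℕ} (M : Matrix (Fin d) (Fin d) ℝ) (S : Finset (Fin d)) (φ : ℝ) : Prop :=
  ∀ β ∈ cone S, φ ^ 2 * ‖β‖ ^ 2 ≤ β.ofLp ⬝ᵥ (M *ᵥ β.ofLp)

/-- Relaxed symmetry `p(-x) / p(x) ≤ ν`, written without division. -/
def RelaxedSymmetry {K d : ℕ} (p : Context K d → ℝ) (ν : ℝ) : Prop :=
  ∀ᵐ x : Context K d, p (-x) ≤ ν * p x

/-- The normalized negative log-likelihood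
`ℓ_n(β) = -(1/n) ∑_{s=1}^n [y_s x_sᵀβ - m(x_sᵀβ)]` of a generalized linear model. -/
def glmLoss {d : ℕ} (m : ℝ → ℝ) (n : ℕ) (x : ℕ → Feature d) (y : ℕ → ℝ) (β : Feature d) : ℝ :=
  -(1 / (n : ℝ)) * ∑ s ∈ Finset.Icc 1 n, (y s * inner ℝ (x s) β - m (inner ℝ (x s) β))

/-- `β'` is a Lasso estimate with penalty `lam`: it minimizes `ℓ_n(β) + lam ‖β‖₁` over `ℝ^d`. -/
def IsLassoEstimate {d : ℕ} (m : ℝ → ℝ) (n : ℕ) (lam : ℝ) (x : ℕ → Feature d) (y : ℕ → ℝ)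
    (β' : Feature d) : Prop :=
  IsMinOn (fun β => glmLoss m n x y β + lam * l1Norm β) Set.univ β'

/-- The penalty `λ_t = λ₀ √((4 log t + 2 log d) / t)`. -/
def penalty (lam0 : ℝ) (d t : ℕ) : ℝ :=
  lam0 * Real.sqrt ((4 * Real.log t + 2 * Real.log d) / t)

/-- The greedy arm for the parameter `β` among two arms; a tie is decided by the coin `c`. -/
def greedyArm {d : ℕ} (x : Context 2 d) (β : Feature d) (c : Fin 2) : Fin 2 :=
  if inner ℝ (x 1) β < inner ℝ (x 0) β then 0
  else if inner ℝ (x 0) β < inner ℝ (x 1) β then 1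
  else c

section BanditModel

variable {Ω : Type*} [mΩ : MeasurableSpace Ω] {d : ℕ}

/-- The reward `Y_{t,i} = μ(X_{t,i}ᵀ β*) + ε_{t,i}`. -/
def reward {K : ℕ} (link : ℝ → ℝ) (βstar : Feature d) (X : ℕ → Ω → Context K d)
    (ε : ℕ → Fin K → Ω → ℝ) (t : ℕ) (i : Fin K) (ω : Ω) : ℝ :=
  link (inner ℝ (X t ω i) βstar) + ε t i ω

/-- What is known before round `t + 1` is played, including the contexts of that round and the
coin that would decide a tie, but not the noise of that round. -/
abbrev preRewardInfo (F : Filtration ℕ mΩ) (X : ℕ → Ω → Context 2 d) (c : ℕ → Ω → Fin 2) (t : ℕ) :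
    MeasurableSpace Ω :=
  F t ⊔ MeasurableSpace.comap (fun ω => (X (t + 1) ω, c (t + 1) ω)) inferInstance

/-- The stochastic environment of the two-armed bandit. Rounds are `1, 2, …`, and `F t` is the
information at the end of round `t`. The contexts are i.i.d. with density `p`, the tie-breaking
coins are fair, and both are independent of the past; the noise is centered and `σ`-sub-Gaussian
given the past and the current contexts. -/
structure IsEnvironment (P : Measure Ω) (F : Filtration ℕ mΩ) (p : Context 2 d → ℝ) (σ : ℝ)
    (X : ℕ → Ω → Context 2 d) (c : ℕ → Ω → Fin 2) (ε : ℕ → Fin 2 → Ω → ℝ) : Prop where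
  measurable_context : ∀ t, Measurable[F (t + 1)] (X (t + 1))
  measurable_coin : ∀ t, Measurable[F (t + 1)] (c (t + 1))
  measurable_noise : ∀ t i, Measurable[F (t + 1)] (ε (t + 1) i)
  context_law : ∀ t, P.map (X (t + 1)) = contextLaw p
  coin_law : ∀ t i, P {ω | c (t + 1) ω = i} = 1 / 2
  context_indep_coin : ∀ t, IndepFun (X (t + 1)) (c (t + 1)) P
  indep_past : ∀ t, Indep
    (MeasurableSpace.comap (fun ω => (X (t + 1) ω, c (t + 1) ω)) inferInstance) (F t) P
  noise_integrable : ∀ t i, Integrable (ε (t + 1) i) P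
  noise_centered : ∀ t i, P[ε (t + 1) i | preRewardInfo F X c t] =ᵐ[P] 0
  noise_exp_integrable : ∀ t i (α : ℝ), Integrable (fun ω => Real.exp (α * ε (t + 1) i ω)) P
  noise_subgaussian : ∀ t i (α : ℝ),
    P[fun ω => Real.exp (α * ε (t + 1) i ω) | preRewardInfo F X c t] ≤ᵐ[P]
      fun _ => Real.exp (α ^ 2 * σ ^ 2 / 2)

/-- The arm pulled in round `t` when the current estimate is `βhat t`. -/
def pulledArm (X : ℕ → Ω → Context 2 d) (c : ℕ → Ω → Fin 2) (βhat : ℕ → Ω → Feature d)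
    (t : ℕ) (ω : Ω) : Fin 2 :=
  greedyArm (X t ω) (βhat t ω) (c t ω)

/-- `βhat` is a sequence of estimates produced by the SA Lasso Bandit algorithm with input
parameter `lam0`. The estimate of round `1` is arbitrary; the estimate of round `t + 1` depends
only on the past and is a Lasso estimate computed, with penalty `λ_t`, from the features and
rewards of the arms pulled in rounds `1, …, t`. -/
structure IsSALassoBandit (P : Measure Ω) (F : Filtration ℕ mΩ) (link m : ℝ → ℝ) (lam0 : ℝ)
    (βstar : Feature d) (X : ℕ → Ω → Context 2 d) (c : ℕ → Ω → Fin 2) (ε : ℕ → Fin 2 → Ω → ℝ)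
    (βhat : ℕ → Ω → Feature d) : Prop where
  nonanticipating : ∀ t, Measurable[F t] (βhat (t + 1))
  lasso : ∀ t, 1 ≤ t → ∀ᵐ ω ∂P,
    IsLassoEstimate m t (penalty lam0 d t)
      (fun s => X s ω (pulledArm X c βhat s ω))
      (fun s => reward link βstar X ε s (pulledArm X c βhat s ω) ω)
      (βhat (t + 1) ω)

/-- The regret of round `t` of the sequence of arms `a`. -/
def instantRegret {K : ℕ} (link : ℝ → ℝ) (βstar : Feature d) (X : ℕ → Ω → Context K d)
    (a : ℕ → Ω → Fin K) (t : ℕ) (ω : Ω) : ℝ :=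
  (⨆ i, link (inner ℝ (X t ω i) βstar)) - link (inner ℝ (X t ω (a t ω)) βstar)

/-- The expected cumulative regret over `T` rounds. -/
def expectedRegret {K : ℕ} (P : Measure Ω) (link : ℝ → ℝ) (βstar : Feature d)
    (X : ℕ → Ω → Context K d) (a : ℕ → Ω → Fin K) (T : ℕ) : ℝ :=
  ∑ t ∈ Finset.Icc 1 T, ∫ ω, instantRegret link βstar X a t ω ∂P

end BanditModel

/-- The constant `C₂(φ₁, s₀) = min (1/2) (φ₁² / (256 s₀ ν x_max²))`. -/
def C2 (φ1 : ℝ) (s0 : ℕ) (ν xmax : ℝ) : ℝ :=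
  min (1 / 2) (φ1 ^ 2 / (256 * s0 * ν * xmax ^ 2))

end SparseBandit

end

/-!
A regret bound for the greedy Lasso bandit with two arms.

After `n` rounds the Lasso error `Δ = β̂ - β*` is controlled as in a fixed design. First-order
optimality of `β̂` and strong monotonicity of the link function give
`κ₀ Δᵀ Σ̂ Δ ≤ λ (3/2 ‖Δ_S‖₁ - 1/2 ‖Δ_{Sᶜ}‖₁)` as soon as the noise is dominated by `λ / 2`
(`IsLassoEstimate.first_order`, `lasso_error_le`); so `Δ` lies in the cone, and a restricted
eigenvalue of the empirical Gram matrix `Σ̂` yields `‖Δ‖ = O(λ √s₀)`.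

The restricted eigenvalue of `Σ̂` comes from the contexts themselves, without forced exploration.
Reflecting a context exchanges the two arms in the greedy choice, so under relaxed symmetry the
conditional second moment of the pulled feature is at least `Σ / ν`, for every parameter that may
drive the choice (`lintegral_add_le_greedy`, `restricted_eigenvalue_greedy`). An Azuma–Hoeffding
inequality (`measure_abs_ge_le_exp`) keeps each entry of `Σ̂` close to the average of these
conditional moments, and the same inequality bounds the noise. The moment generating functions are
bounded conditionally (`CondSubG`) by replacing `exp` with its chord on a bounded interval; this
handles at once bounded centered increments and the noise multiplied by a predictable feature.

Outside of the failure event, the regret of a round is at most `2 κ₁ x_max ‖Δ‖`, since the pulled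
arm is optimal for `β̂`; on the failure event it is at most `2 κ₁ x_max b`. Summing `λ_n` over the
rounds gives the `√(s₀ T log (d T))` term, and the failure probabilities are summable
(`IsSALassoBandit.integral_instantRegret_le`, `sum_penalty_rate_le`, `sum_failure_le`).
-/

namespace SparseBandit

/-! ### The Lasso oracle inequality -/

section Deterministic

variable {d : ℕ}

lemma inner_eq_sum (x v : Feature d) : inner ℝ x v = ∑ j, x j * v j := by
  simp [PiLp.inner_apply, mul_comm]

lemma l1Norm_nonneg (v : Feature d) : 0 ≤ l1Norm v :=
  Finset.sum_nonneg fun _ _ => abs_nonneg _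

lemma l1Norm_eq_add_compl (S : Finset (Fin d)) (v : Feature d) :
    l1Norm v = ∑ j ∈ S, |v j| + ∑ j ∈ Sᶜ, |v j| :=
  (Finset.sum_add_sum_compl S _).symm

lemma sum_abs_le_sqrt_card_mul_norm (S : Finset (Fin d)) (v : Feature d) :
    ∑ j ∈ S, |v j| ≤ Real.sqrt S.card * ‖v‖ := by
  have h1 : (∑ j ∈ S, |v j|) ^ 2 ≤ S.card * ∑ j ∈ S, |v j| ^ 2 := sq_sum_le_card_mul_sum_sq
  have h2 : ∑ j ∈ S, |v j| ^ 2 ≤ ‖v‖ ^ 2 := by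
    rw [EuclideanSpace.norm_sq_eq]
    simp only [Real.norm_eq_abs]
    exact Finset.sum_le_univ_sum_of_nonneg fun j => sq_nonneg _
  refine abs_le_of_sq_le_sq' ?_ (by positivity) |>.2
  rw [mul_pow, Real.sq_sqrt (Nat.cast_nonneg _)]
  exact h1.trans (mul_le_mul_of_nonneg_left h2 (Nat.cast_nonneg _))

lemma l1Norm_le_of_mem_cone {S : Finset (Fin d)} {v : Feature d} (hv : v ∈ cone S) :
    l1Norm v ≤ 4 * (Real.sqrt S.card * ‖v‖) := by
  have h1 : ∑ j ∈ Sᶜ, |v j| ≤ 3 * ∑ j ∈ S, |v j| := hv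
  have h2 := sum_abs_le_sqrt_card_mul_norm S v
  rw [l1Norm_eq_add_compl S]
  linarith

/-- Decomposition of the `ℓ₁` norm along the active set of `β`. -/
lemma l1Norm_sub_l1Norm_le (β β' : Feature d) :
    l1Norm β - l1Norm β' ≤
      ∑ j ∈ activeSet β, |(β' - β) j| - ∑ j ∈ (activeSet β)ᶜ, |(β' - β) j| := by
  rw [l1Norm_eq_add_compl (activeSet β) β, l1Norm_eq_add_compl (activeSet β) β']
  have h1 : ∑ j ∈ (activeSet β)ᶜ, |β j| = 0 :=
    Finset.sum_eq_zero fun j hj => by simpa [activeSet] using hj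
  have h2 : ∑ j ∈ (activeSet β)ᶜ, |(β' - β) j| = ∑ j ∈ (activeSet β)ᶜ, |β' j| :=
    Finset.sum_congr rfl fun j hj => by
      have : β j = 0 := by simpa [activeSet] using hj
      simp [this]
  have h3 : ∑ j ∈ activeSet β, |β j| ≤
      ∑ j ∈ activeSet β, |β' j| + ∑ j ∈ activeSet β, |(β' - β) j| := by
    rw [← Finset.sum_add_distrib]
    refine Finset.sum_le_sum fun j _ => ?_
    have := abs_sub_abs_le_abs_sub (β j) (β' j)
    rw [abs_sub_comm] at this
    simp only [PiLp.sub_apply]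
    linarith
  linarith

lemma mul_sq_sub_le_of_le_deriv {f : ℝ → ℝ} {κ : ℝ} (hf : Differentiable ℝ f)
    (h : ∀ z, κ ≤ deriv f z) (u v : ℝ) : κ * (u - v) ^ 2 ≤ (f u - f v) * (u - v) := by
  rcases le_total v u with huv | huv
  · have := mul_sub_le_image_sub_of_le_deriv hf h huv
    nlinarith [sub_nonneg.2 huv]
  · have := mul_sub_le_image_sub_of_le_deriv hf h huv
    nlinarith [sub_nonneg.2 huv]

/-- First-order optimality of a Lasso estimate in the direction of an arbitrary `β`. Compared
with the basic inequality `ℓ(β') + λ ‖β'‖₁ ≤ ℓ(β) + λ ‖β‖₁`, it saves a factor `2` in the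
curvature term. -/
lemma IsLassoEstimate.first_order {m link : ℝ → ℝ} (hm : ∀ z, HasDerivAt m (link z) z) {n : ℕ}
    {lam : ℝ} (hlam : 0 ≤ lam) {x : ℕ → Feature d} {y : ℕ → ℝ} {β' : Feature d}
    (h : IsLassoEstimate m n lam x y β') (β : Feature d) :
    0 ≤ (1 / (n : ℝ)) * ∑ s ∈ Finset.Icc 1 n,
        (y s - link (inner ℝ (x s) β')) * inner ℝ (x s) (β' - β)
      + lam * (l1Norm β - l1Norm β') := by
  set g : ℝ → ℝ := fun θ => -(1 / (n : ℝ)) * ∑ s ∈ Finset.Icc 1 n,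
      (y s * (inner ℝ (x s) β' - θ * inner ℝ (x s) (β' - β))
        - m (inner ℝ (x s) β' - θ * inner ℝ (x s) (β' - β)))
    + θ * (lam * (l1Norm β - l1Norm β')) with hg
  have hgl : ∀ θ, g θ = glmLoss m n x y (β' - θ • (β' - β))
      + θ * (lam * (l1Norm β - l1Norm β')) := by
    intro θ
    simp only [hg, glmLoss, inner_sub_right, inner_smul_right]
  have hder : HasDerivAt g ((1 / (n : ℝ)) * ∑ s ∈ Finset.Icc 1 n,
        (y s - link (inner ℝ (x s) β')) * inner ℝ (x s) (β' - β)
      + lam * (l1Norm β - l1Norm β')) 0 := by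
    have hin : ∀ s, HasDerivAt (fun θ : ℝ => inner ℝ (x s) β' - θ * inner ℝ (x s) (β' - β))
        (-(inner ℝ (x s) (β' - β))) 0 := by
      intro s
      simpa using ((hasDerivAt_id (0 : ℝ)).mul_const (inner ℝ (x s) (β' - β))).const_sub
        (inner ℝ (x s) β')
    have hs : ∀ s, HasDerivAt (fun θ : ℝ =>
        y s * (inner ℝ (x s) β' - θ * inner ℝ (x s) (β' - β))
          - m (inner ℝ (x s) β' - θ * inner ℝ (x s) (β' - β)))
        (y s * (-(inner ℝ (x s) (β' - β)))
          - link (inner ℝ (x s) β') * (-(inner ℝ (x s) (β' - β)))) 0 := by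
      intro s
      refine ((hin s).const_mul (y s)).sub ?_
      have := hm (inner ℝ (x s) β' - 0 * inner ℝ (x s) (β' - β))
      have h2 := HasDerivAt.comp (0 : ℝ) this (hin s)
      simpa [Function.comp_def] using h2
    have hsum := HasDerivAt.fun_sum (u := Finset.Icc 1 n) fun s _ => hs s
    refine HasDerivAt.congr_deriv (f := g) ((hsum.const_mul (-(1 / (n : ℝ)))).add
      ((hasDerivAt_id (0 : ℝ)).mul_const (lam * (l1Norm β - l1Norm β')))) ?_
    rw [neg_mul, ← mul_neg, ← Finset.sum_neg_distrib, one_mul]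
    congr 2
    exact Finset.sum_congr rfl fun s _ => by ring
  have hlim := hder.tendsto_slope_zero_right
  refine ge_of_tendsto hlim ?_
  have hev : ∀ᶠ θ : ℝ in nhdsWithin 0 (Set.Ioi 0), θ ∈ Set.Ioo (0 : ℝ) 1 :=
    Ioo_mem_nhdsGT one_pos
  filter_upwards [hev] with θ hθ
  have hmin := h (Set.mem_univ (β' - θ • (β' - β)))
  simp only [Set.mem_ofPred_eq] at hmin
  have hconv : l1Norm (β' - θ • (β' - β)) ≤ l1Norm β' + θ * (l1Norm β - l1Norm β') := by
    have : l1Norm β' + θ * (l1Norm β - l1Norm β') = ∑ j, ((1 - θ) * |β' j| + θ * |β j|) := by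
      simp only [l1Norm, Finset.sum_add_distrib, ← Finset.mul_sum]
      ring
    rw [this]
    refine Finset.sum_le_sum fun j _ => ?_
    have h3 : (β' - θ • (β' - β)) j = (1 - θ) * β' j + θ * β j := by
      simp only [PiLp.sub_apply, PiLp.smul_apply, smul_eq_mul]; ring
    rw [h3]
    refine (abs_add_le _ _).trans ?_
    rw [abs_mul, abs_mul, abs_of_pos hθ.1, abs_of_pos (sub_pos.2 hθ.2)]
  have h4 := mul_le_mul_of_nonneg_left hconv hlam
  rw [zero_add, hgl, hgl, smul_eq_mul]
  refine mul_nonneg (inv_nonneg.2 hθ.1.le) ?_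
  simp only [zero_smul, sub_zero, zero_mul, add_zero]
  linarith

/-- An entrywise bound on a matrix bounds its quadratic form by the squared `ℓ₁` norm. -/
lemma abs_quadratic_le (A : Fin d → Fin d → ℝ) {δ : ℝ} (hA : ∀ i j, |A i j| ≤ δ)
    (v : Feature d) : |∑ i, ∑ j, v i * v j * A i j| ≤ δ * l1Norm v ^ 2 := by
  have : δ * l1Norm v ^ 2 = ∑ i, ∑ j, |v i| * |v j| * δ := by
    rw [sq, l1Norm, Finset.sum_mul_sum, Finset.mul_sum]
    refine Finset.sum_congr rfl fun i _ => ?_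
    rw [Finset.mul_sum]
    exact Finset.sum_congr rfl fun j _ => by ring
  rw [this]
  refine (Finset.abs_sum_le_sum_abs _ _).trans (Finset.sum_le_sum fun i _ => ?_)
  refine (Finset.abs_sum_le_sum_abs _ _).trans (Finset.sum_le_sum fun j _ => ?_)
  rw [abs_mul, abs_mul]
  exact mul_le_mul_of_nonneg_left (hA i j) (by positivity)

lemma sq_inner_eq_sum (x v : Feature d) :
    inner ℝ x v ^ 2 = ∑ i, ∑ j, v i * v j * (x i * x j) := by
  rw [inner_eq_sum, sq, Finset.sum_mul_sum]
  exact Finset.sum_congr rfl fun i _ => Finset.sum_congr rfl fun j _ => by ring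

/-- Lasso oracle inequality for an adaptive design. The matrices `H s` play the role of the
conditional second moments of the features; their average has restricted eigenvalue `ρ`, and
the empirical Gram matrix is entrywise `δ`-close to that average. -/
theorem lasso_error_le {m link : ℝ → ℝ} {κ0 : ℝ} (hκ0 : 0 < κ0) (hlink : Differentiable ℝ link)
    (hκ : ∀ z, κ0 ≤ deriv link z) (hm : ∀ z, HasDerivAt m (link z) z) {n : ℕ} (hn : 1 ≤ n)
    {lam : ℝ} (hlam : 0 < lam) {x : ℕ → Feature d} {e : ℕ → ℝ} {β' βstar : Feature d}
    (h : IsLassoEstimate m n lam x (fun s => link (inner ℝ (x s) βstar) + e s) β')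
    (he : ∀ j, |∑ s ∈ Finset.Icc 1 n, e s * x s j| ≤ n * (lam / 2))
    (H : ℕ → Fin d → Fin d → ℝ) {ρ δ : ℝ} (hρ : 0 < ρ)
    (hH : ∀ v ∈ cone (activeSet βstar), ∀ s ∈ Finset.Icc 1 n,
      ρ * ‖v‖ ^ 2 ≤ ∑ i, ∑ j, v i * v j * H s i j)
    (hdev : ∀ i j, |∑ s ∈ Finset.Icc 1 n, (x s i * x s j - H s i j)| ≤ n * δ)
    (hδ : 32 * (activeSet βstar).card * δ ≤ ρ) :
    ‖β' - βstar‖ ≤ 3 * lam * Real.sqrt (activeSet βstar).card / (κ0 * ρ) := by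
  set S := activeSet βstar
  set Δ := β' - βstar with hΔ
  have hn0 : (0 : ℝ) < n := by exact_mod_cast hn
  have hfirst := h.first_order hm hlam.le βstar
  have hnoise : ∑ s ∈ Finset.Icc 1 n, e s * inner ℝ (x s) Δ ≤ n * (lam / 2) * l1Norm Δ := by
    have h1 : ∑ s ∈ Finset.Icc 1 n, e s * inner ℝ (x s) Δ
        = ∑ j, (∑ s ∈ Finset.Icc 1 n, e s * x s j) * Δ j := by
      simp only [inner_eq_sum, Finset.mul_sum, Finset.sum_mul]
      rw [Finset.sum_comm]
      exact Finset.sum_congr rfl fun j _ => Finset.sum_congr rfl fun s _ => by ring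
    rw [h1, l1Norm, Finset.mul_sum]
    refine Finset.sum_le_sum fun j _ => (le_abs_self _).trans ?_
    rw [abs_mul]
    exact mul_le_mul_of_nonneg_right (he j) (abs_nonneg _)
  have hcurv : κ0 * ∑ s ∈ Finset.Icc 1 n, inner ℝ (x s) Δ ^ 2 ≤
      n * (lam / 2) * l1Norm Δ + n * (lam * (l1Norm βstar - l1Norm β')) := by
    have h1 : ∑ s ∈ Finset.Icc 1 n,
        ((link (inner ℝ (x s) βstar) + e s) - link (inner ℝ (x s) β')) * inner ℝ (x s) Δ
        ≤ ∑ s ∈ Finset.Icc 1 n, (e s * inner ℝ (x s) Δ - κ0 * inner ℝ (x s) Δ ^ 2) := by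
      refine Finset.sum_le_sum fun s _ => ?_
      have := mul_sq_sub_le_of_le_deriv hlink hκ (inner ℝ (x s) β') (inner ℝ (x s) βstar)
      rw [← inner_sub_right, ← hΔ] at this
      linarith
    rw [Finset.sum_sub_distrib, ← Finset.mul_sum] at h1
    have h2 := mul_le_mul_of_nonneg_left hfirst hn0.le
    rw [mul_zero, mul_add, ← mul_assoc, mul_one_div_cancel hn0.ne', one_mul] at h2
    linarith
  have hdiff := l1Norm_sub_l1Norm_le βstar β'
  have hsplit := l1Norm_eq_add_compl S Δ
  have hS0 : 0 ≤ ∑ j ∈ S, |Δ j| := Finset.sum_nonneg fun _ _ => abs_nonneg _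
  have hSc0 : 0 ≤ ∑ j ∈ Sᶜ, |Δ j| := Finset.sum_nonneg fun _ _ => abs_nonneg _
  have hq0 : 0 ≤ ∑ s ∈ Finset.Icc 1 n, inner ℝ (x s) Δ ^ 2 :=
    Finset.sum_nonneg fun _ _ => sq_nonneg _
  have hmain : κ0 * ∑ s ∈ Finset.Icc 1 n, inner ℝ (x s) Δ ^ 2 ≤
      n * lam * (3 / 2 * ∑ j ∈ S, |Δ j| - 1 / 2 * ∑ j ∈ Sᶜ, |Δ j|) := by
    have h1 : n * (lam * (l1Norm βstar - l1Norm β')) ≤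
        n * (lam * (∑ j ∈ S, |Δ j| - ∑ j ∈ Sᶜ, |Δ j|)) := by gcongr
    rw [hsplit] at hcurv
    linarith
  have hcone : Δ ∈ cone S := by
    have h1 : 0 ≤ n * lam * (3 / 2 * ∑ j ∈ S, |Δ j| - 1 / 2 * ∑ j ∈ Sᶜ, |Δ j|) :=
      le_trans (by positivity) hmain
    have h2 := nonneg_of_mul_nonneg_right h1 (by positivity)
    change ∑ j ∈ Sᶜ, |Δ j| ≤ 3 * ∑ j ∈ S, |Δ j|
    linarith
  have hgram : n * (ρ / 2 * ‖Δ‖ ^ 2) ≤ ∑ s ∈ Finset.Icc 1 n, inner ℝ (x s) Δ ^ 2 := by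
    have h1 : n * (ρ * ‖Δ‖ ^ 2) ≤ ∑ s ∈ Finset.Icc 1 n, ∑ i, ∑ j, Δ i * Δ j * H s i j := by
      have := Finset.sum_le_sum fun s hs => hH Δ hcone s hs
      simpa using this
    have h2 := abs_quadratic_le _ hdev Δ
    have h3 : ∑ i, ∑ j, Δ i * Δ j * ∑ s ∈ Finset.Icc 1 n, (x s i * x s j - H s i j)
        = ∑ s ∈ Finset.Icc 1 n, inner ℝ (x s) Δ ^ 2
          - ∑ s ∈ Finset.Icc 1 n, ∑ i, ∑ j, Δ i * Δ j * H s i j := by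
      simp only [sq_inner_eq_sum]
      rw [← Finset.sum_sub_distrib, eq_comm]
      simp only [← Finset.sum_sub_distrib, Finset.mul_sum, mul_sub]
      rw [Finset.sum_comm]
      exact Finset.sum_congr rfl fun i _ => Finset.sum_comm
    rw [h3] at h2
    have h4 := (abs_le.1 h2).1
    have h5 : l1Norm Δ ^ 2 ≤ 16 * S.card * ‖Δ‖ ^ 2 := by
      have := pow_le_pow_left₀ (l1Norm_nonneg Δ) (l1Norm_le_of_mem_cone hcone) 2
      rw [mul_pow, mul_pow, Real.sq_sqrt (Nat.cast_nonneg _)] at this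
      linarith
    have hδ0 : 0 ≤ n * δ ∨ d = 0 := by
      rcases Nat.eq_zero_or_pos d with hd | hd
      · exact Or.inr hd
      · exact Or.inl ((abs_nonneg _).trans (hdev ⟨0, hd⟩ ⟨0, hd⟩))
    have h6 : n * δ * l1Norm Δ ^ 2 ≤ n * (ρ / 2 * ‖Δ‖ ^ 2) := by
      rcases hδ0 with hδ0 | hd
      · have h7 : n * δ * l1Norm Δ ^ 2 ≤ n * δ * (16 * S.card * ‖Δ‖ ^ 2) := by gcongr
        have h8 : (n : ℝ) * ‖Δ‖ ^ 2 * (32 * S.card * δ) ≤ n * ‖Δ‖ ^ 2 * ρ := by gcongr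
        linarith
      · subst hd
        simp only [l1Norm, Finset.univ_eq_empty, Finset.sum_empty]
        ring_nf
        positivity
    linarith
  have hfin : κ0 * ρ * ‖Δ‖ * ‖Δ‖ ≤ 3 * lam * Real.sqrt S.card * ‖Δ‖ := by
    have h1 := sum_abs_le_sqrt_card_mul_norm S Δ
    have h2 := mul_le_mul_of_nonneg_left hgram hκ0.le
    have h3 : n * lam * (3 / 2 * ∑ j ∈ S, |Δ j| - 1 / 2 * ∑ j ∈ Sᶜ, |Δ j|) ≤
        n * lam * (3 / 2 * (Real.sqrt S.card * ‖Δ‖)) := by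
      gcongr
      linarith
    refine le_of_mul_le_mul_left ?_ hn0
    linarith
  rw [le_div_iff₀ (by positivity)]
  rcases (norm_nonneg Δ).eq_or_lt with h0 | h0
  · rw [← h0, zero_mul]
    positivity
  · have := le_of_mul_le_mul_right hfin h0
    linarith

end Deterministic

/-! ### Conditionally sub-Gaussian increments -/

section Concentration

variable {Ω : Type*} {m mΩ : MeasurableSpace Ω}

/-- `D` is sub-Gaussian with parameter `K` conditionally on the σ-algebra `m`. The bound on the
conditional moment generating function is tested against nonnegative `m`-measurable weights;
with values in `[0, ∞]`, no integrability has to be tracked. -/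
def CondSubG {Ω : Type*} (m : MeasurableSpace Ω) {mΩ : MeasurableSpace Ω} (P : Measure Ω) (K : ℝ) (D : Ω → ℝ) : Prop :=
  ∀ (α : ℝ) (W : Ω → ENNReal), Measurable[m] W →
    ∫⁻ ω, W ω * ENNReal.ofReal (Real.exp (α * D ω)) ∂P
      ≤ ENNReal.ofReal (Real.exp (α ^ 2 * K ^ 2 / 2)) * ∫⁻ ω, W ω ∂P

variable {P : Measure Ω} {K : ℝ} {D : Ω → ℝ}

lemma CondSubG.neg (h : CondSubG m P K D) : CondSubG m P K (fun ω => -D ω) := by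
  intro α W hW
  simpa using h (-α) W hW

lemma CondSubG.mono {m' : MeasurableSpace Ω} (h : CondSubG m P K D) (hm : m' ≤ m) :
    CondSubG m' P K D := fun α W hW => h α W (hW.mono hm le_rfl)

lemma CondSubG.of_condExp [IsProbabilityMeasure P] (hm : m ≤ mΩ) (hD : Measurable D)
    (hint : ∀ α : ℝ, Integrable (fun ω => Real.exp (α * D ω)) P)
    (h : ∀ α : ℝ, P[fun ω => Real.exp (α * D ω) | m] ≤ᵐ[P]
      fun _ => Real.exp (α ^ 2 * K ^ 2 / 2)) :
    CondSubG m P K D := by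
  intro α W hW
  set c := Real.exp (α ^ 2 * K ^ 2 / 2) with hc
  set f : Ω → ENNReal := fun ω => ENNReal.ofReal (Real.exp (α * D ω)) with hf
  have hfm : Measurable f := by fun_prop
  have hle : (P.withDensity f).trim hm ≤ ENNReal.ofReal c • P.trim hm := by
    refine Measure.le_iff.2 fun s hs => ?_
    rw [trim_measurableSet_eq hm hs, withDensity_apply _ (hm s hs), Measure.smul_apply,
      trim_measurableSet_eq hm hs, smul_eq_mul,
      ← ofReal_integral_eq_lintegral_ofReal (hint α).integrableOn
        (Filter.Eventually.of_forall fun _ => (Real.exp_pos _).le),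
      ← setIntegral_condExp hm (hint α) hs]
    have h1 : ∫ ω in s, (P[fun ω => Real.exp (α * D ω) | m]) ω ∂P ≤ ∫ ω in s, c ∂P :=
      setIntegral_mono_ae integrable_condExp.integrableOn (integrable_const c).integrableOn (h α)
    rw [setIntegral_const, smul_eq_mul] at h1
    refine (ENNReal.ofReal_le_ofReal h1).trans ?_
    rw [mul_comm, ENNReal.ofReal_mul (Real.exp_pos _).le, ofReal_measureReal]
  have h2 : ∫⁻ ω, W ω * f ω ∂P = ∫⁻ ω, W ω ∂((P.withDensity f).trim hm) := by
    rw [lintegral_trim hm hW, lintegral_withDensity_eq_lintegral_mul _ hfm (hW.mono hm le_rfl)]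
    simp [mul_comm]
  calc ∫⁻ ω, W ω * f ω ∂P ≤ ∫⁻ ω, W ω ∂(ENNReal.ofReal c • P.trim hm) := by
        rw [h2]; exact lintegral_mono' hle le_rfl
    _ = ENNReal.ofReal c * ∫⁻ ω, W ω ∂P := by
        rw [lintegral_smul_measure, lintegral_trim hm hW, smul_eq_mul]

/-- The exponential lies below its chord over the segment between `-B * y` and `B * y`. -/
lemma exp_mul_le_of_abs_le {B z : ℝ} (hB : 0 < B) (hz : |z| ≤ B) (y : ℝ) :
    Real.exp (z * y) ≤ (B + z) / (2 * B) * Real.exp (B * y)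
      + (B - z) / (2 * B) * Real.exp (-B * y) := by
  have h1 := abs_le.1 hz
  have h := convexOn_exp.2 (Set.mem_univ (B * y)) (Set.mem_univ (-B * y))
    (show 0 ≤ (B + z) / (2 * B) from div_nonneg (by linarith) (by linarith))
    (show 0 ≤ (B - z) / (2 * B) from div_nonneg (by linarith) (by linarith))
    (by field_simp; ring)
  have e : (B + z) / (2 * B) * (B * y) + (B - z) / (2 * B) * (-B * y) = z * y := by
    field_simp
    ring
  simpa only [smul_eq_mul, e] using h

lemma ofReal_exp_mul_le_of_abs_le {B z : ℝ} (hB : 0 < B) (hz : |z| ≤ B) (y : ℝ) :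
    ENNReal.ofReal (Real.exp (z * y)) ≤
      ENNReal.ofReal ((B + z) / (2 * B)) * ENNReal.ofReal (Real.exp (B * y))
      + ENNReal.ofReal ((B - z) / (2 * B)) * ENNReal.ofReal (Real.exp (-B * y)) := by
  have h1 := abs_le.1 hz
  have h2 : 0 ≤ (B + z) / (2 * B) := div_nonneg (by linarith) (by linarith)
  have h3 : 0 ≤ (B - z) / (2 * B) := div_nonneg (by linarith) (by linarith)
  rw [← ENNReal.ofReal_mul h2, ← ENNReal.ofReal_mul h3, ← ENNReal.ofReal_add (by positivity)
    (by positivity)]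
  exact ENNReal.ofReal_le_ofReal (exp_mul_le_of_abs_le hB hz y)

/-- A bounded predictable multiplier keeps conditional sub-Gaussianity: by convexity, it acts as
a random mixture of the two constant multipliers `B` and `-B`. -/
lemma CondSubG.mul_of_abs_le (hm : m ≤ mΩ) (h : CondSubG m P K D) (hD : Measurable D)
    {Z : Ω → ℝ} (hZ : Measurable[m] Z) {B : ℝ} (hB : 0 < B) (hZB : ∀ᵐ ω ∂P, |Z ω| ≤ B) :
    CondSubG m P (K * B) (fun ω => D ω * Z ω) := by
  intro α W hW
  set c := ENNReal.ofReal (Real.exp (α ^ 2 * (K * B) ^ 2 / 2)) with hc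
  set wp : Ω → ENNReal := fun ω => ENNReal.ofReal ((B + Z ω) / (2 * B)) with hwp
  set wm : Ω → ENNReal := fun ω => ENNReal.ofReal ((B - Z ω) / (2 * B)) with hwm
  have hwp_meas : Measurable[m] wp :=
    ENNReal.measurable_ofReal.comp (((hZ.const_add B)).div_const (2 * B))
  have hwm_meas : Measurable[m] wm :=
    ENNReal.measurable_ofReal.comp (((hZ.const_sub B)).div_const (2 * B))
  have hWp : Measurable[m] fun ω => W ω * wp ω := hW.mul hwp_meas
  have hWm : Measurable[m] fun ω => W ω * wm ω := hW.mul hwm_meas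
  have hp := h (α * B) _ hWp
  have hn := h (-(α * B)) _ hWm
  have e1 : (α * B) ^ 2 * K ^ 2 / 2 = α ^ 2 * (K * B) ^ 2 / 2 := by ring
  have e2 : (-(α * B)) ^ 2 * K ^ 2 / 2 = α ^ 2 * (K * B) ^ 2 / 2 := by ring
  rw [e1, ← hc] at hp
  rw [e2, ← hc] at hn
  have hWp' := hWp.mono hm le_rfl
  calc ∫⁻ ω, W ω * ENNReal.ofReal (Real.exp (α * (D ω * Z ω))) ∂P
      ≤ ∫⁻ ω, (W ω * wp ω * ENNReal.ofReal (Real.exp (α * B * D ω))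
          + W ω * wm ω * ENNReal.ofReal (Real.exp (-(α * B) * D ω))) ∂P := by
        refine lintegral_mono_ae ?_
        filter_upwards [hZB] with ω hω
        have := mul_le_mul_right (ofReal_exp_mul_le_of_abs_le hB hω (α * D ω)) (W ω)
        rw [mul_add] at this
        have e3 : α * (D ω * Z ω) = Z ω * (α * D ω) := by ring
        have e4 : α * B * D ω = B * (α * D ω) := by ring
        have e5 : -(α * B) * D ω = -B * (α * D ω) := by ring
        rw [e3, e4, e5, mul_assoc (W ω), mul_assoc (W ω)]
        exact this
    _ = ∫⁻ ω, W ω * wp ω * ENNReal.ofReal (Real.exp (α * B * D ω)) ∂P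
        + ∫⁻ ω, W ω * wm ω * ENNReal.ofReal (Real.exp (-(α * B) * D ω)) ∂P :=
        lintegral_add_left (hWp'.mul (by fun_prop)) _
    _ ≤ c * ∫⁻ ω, W ω * wp ω ∂P + c * ∫⁻ ω, W ω * wm ω ∂P := add_le_add hp hn
    _ = c * ∫⁻ ω, W ω ∂P := by
        rw [← mul_add, ← lintegral_add_left hWp']
        congr 1
        refine lintegral_congr_ae ?_
        filter_upwards [hZB] with ω hω
        have h1 := abs_le.1 hω
        rw [← mul_add, hwp, hwm, ← ENNReal.ofReal_add (div_nonneg (by linarith) (by linarith))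
          (div_nonneg (by linarith) (by linarith))]
        have : (B + Z ω) / (2 * B) + (B - Z ω) / (2 * B) = 1 := by field_simp; ring
        rw [this, ENNReal.ofReal_one, mul_one]

/-- A predictable selection among conditionally sub-Gaussian variables. -/
lemma CondSubG.select {ι : Type*} [Fintype ι] [MeasurableSpace ι] [MeasurableSingletonClass ι]
    (hm : m ≤ mΩ) {D : ι → Ω → ℝ} (h : ∀ i, CondSubG m P K (D i)) (hD : ∀ i, Measurable (D i))
    {a : Ω → ι} (ha : Measurable[m] a) : CondSubG m P K (fun ω => D (a ω) ω) := by
  classical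
  intro α W hW
  have hWi : ∀ i, Measurable[m] ((a ⁻¹' {i}).indicator W) := fun i =>
    hW.indicator (ha (measurableSet_singleton i))
  have hsplit : ∀ G : ι → Ω → ENNReal, ∀ ω,
      W ω * G (a ω) ω = ∑ i, (a ⁻¹' {i}).indicator W ω * G i ω := by
    intro G ω
    rw [Finset.sum_eq_single (a ω)]
    · simp
    · intro i _ hi
      have : ω ∉ a ⁻¹' {i} := fun h => hi (by simpa using h.symm)
      simp [Set.indicator_of_notMem this]
    · simp
  have h2 := hsplit (fun _ _ => 1)
  simp only [mul_one] at h2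
  simp_rw [hsplit (fun i ω => ENNReal.ofReal (Real.exp (α * D i ω))), h2]
  have hmeas : ∀ i, Measurable fun ω =>
      (a ⁻¹' {i}).indicator W ω * ENNReal.ofReal (Real.exp (α * D i ω)) := fun i =>
    ((hWi i).mono hm le_rfl).mul (by have := hD i; fun_prop)
  rw [lintegral_finsetSum _ fun i _ => hmeas i,
    lintegral_finsetSum _ fun i _ => (hWi i).mono hm le_rfl, Finset.mul_sum]
  exact Finset.sum_le_sum fun i _ => h i α _ (hWi i)

/-- Conditional Hoeffding lemma for a centered variable with `|D| ≤ K`; being centered is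
expressed by the weighted integrals of the nonnegative variables `K ± D`. -/
lemma CondSubG.of_abs_le (hm : m ≤ mΩ) (hD : Measurable D) (hK : 0 < K)
    (hDK : ∀ᵐ ω ∂P, |D ω| ≤ K)
    (hp : ∀ W : Ω → ENNReal, Measurable[m] W →
      ∫⁻ ω, W ω * ENNReal.ofReal (K + D ω) ∂P = ENNReal.ofReal K * ∫⁻ ω, W ω ∂P)
    (hn : ∀ W : Ω → ENNReal, Measurable[m] W →
      ∫⁻ ω, W ω * ENNReal.ofReal (K - D ω) ∂P = ENNReal.ofReal K * ∫⁻ ω, W ω ∂P) :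
    CondSubG m P K D := by
  intro α W hW
  have hW' := hW.mono hm le_rfl
  have hWp : Measurable fun ω => W ω * ENNReal.ofReal (K + D ω) := hW'.mul (by fun_prop)
  have hWn : Measurable fun ω => W ω * ENNReal.ofReal (K - D ω) := hW'.mul (by fun_prop)
  set A := ENNReal.ofReal (Real.exp (K * α) / (2 * K)) with hA
  set B := ENNReal.ofReal (Real.exp (-K * α) / (2 * K)) with hB
  calc ∫⁻ ω, W ω * ENNReal.ofReal (Real.exp (α * D ω)) ∂P
      ≤ ∫⁻ ω, (A * (W ω * ENNReal.ofReal (K + D ω))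
          + B * (W ω * ENNReal.ofReal (K - D ω))) ∂P := by
        refine lintegral_mono_ae ?_
        filter_upwards [hDK] with ω hω
        have h1 := abs_le.1 hω
        have h0 := exp_mul_le_of_abs_le hK hω α
        have h2 : Real.exp (α * D ω) ≤ Real.exp (K * α) / (2 * K) * (K + D ω)
            + Real.exp (-K * α) / (2 * K) * (K - D ω) := by
          rw [mul_comm α]
          refine h0.trans (le_of_eq ?_)
          ring
        have h3 := ENNReal.ofReal_le_ofReal h2
        rw [ENNReal.ofReal_add (mul_nonneg (by positivity) (by linarith))
          (mul_nonneg (by positivity) (by linarith)), ENNReal.ofReal_mul (by positivity),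
          ENNReal.ofReal_mul (by positivity)] at h3
        refine (mul_le_mul_right h3 (W ω)).trans (le_of_eq ?_)
        ring
    _ = (A + B) * (ENNReal.ofReal K * ∫⁻ ω, W ω ∂P) := by
        rw [lintegral_add_left (hWp.const_mul A), lintegral_const_mul _ hWp,
          lintegral_const_mul _ hWn, hp W hW, hn W hW, add_mul]
    _ ≤ ENNReal.ofReal (Real.exp (α ^ 2 * K ^ 2 / 2)) * ∫⁻ ω, W ω ∂P := by
        rw [← mul_assoc]
        refine mul_le_mul_left ?_ _
        rw [hA, hB, ← ENNReal.ofReal_add (by positivity) (by positivity),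
          ← ENNReal.ofReal_mul (by positivity)]
        refine ENNReal.ofReal_le_ofReal ?_
        have h1 := Real.cosh_le_exp_half_sq (K * α)
        rw [Real.cosh_eq] at h1
        have h2 : (K * α) ^ 2 / 2 = α ^ 2 * K ^ 2 / 2 := by ring
        rw [h2] at h1
        refine le_trans (le_of_eq ?_) h1
        rw [neg_mul]
        field_simp

lemma lintegral_exp_sum_le [IsProbabilityMeasure P] (F : Filtration ℕ mΩ) {D : ℕ → Ω → ℝ}
    (hD : ∀ s, Measurable[F (s + 1)] (D s)) (h : ∀ s, CondSubG (F s) P K (D s)) (α : ℝ) (n : ℕ) :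
    ∫⁻ ω, ENNReal.ofReal (Real.exp (α * ∑ s ∈ Finset.range n, D s ω)) ∂P
      ≤ ENNReal.ofReal (Real.exp (n * (α ^ 2 * K ^ 2 / 2))) := by
  induction n with
  | zero => simp
  | succ n ih =>
    have hmeas : Measurable[F n] fun ω =>
        ENNReal.ofReal (Real.exp (α * ∑ s ∈ Finset.range n, D s ω)) := by
      refine ENNReal.measurable_ofReal.comp (Real.measurable_exp.comp (Measurable.const_mul ?_ α))
      exact Finset.measurable_sum _ fun s hs =>
        (hD s).mono (F.mono (by have := Finset.mem_range.1 hs; omega)) le_rfl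
    have h1 := h n α _ hmeas
    simp only [Finset.sum_range_succ, mul_add, Real.exp_add]
    simp_rw [ENNReal.ofReal_mul (Real.exp_pos _).le]
    refine h1.trans ((mul_le_mul_right ih _).trans (le_of_eq ?_))
    rw [← ENNReal.ofReal_mul (Real.exp_pos _).le, ← Real.exp_add]
    congr 2
    push_cast
    ring

/-- Azuma–Hoeffding inequality, one-sided, by the Chernoff bound. -/
lemma measure_ge_le_exp [IsProbabilityMeasure P] (F : Filtration ℕ mΩ) {D : ℕ → Ω → ℝ}
    (hD : ∀ s, Measurable[F (s + 1)] (D s)) (h : ∀ s, CondSubG (F s) P K (D s)) (hK : 0 < K)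
    {n : ℕ} (hn : 1 ≤ n) {u : ℝ} (hu : 0 ≤ u) :
    P {ω | u ≤ ∑ s ∈ Finset.range n, D s ω} ≤
      ENNReal.ofReal (Real.exp (-(u ^ 2 / (2 * n * K ^ 2)))) := by
  have hn0 : (0 : ℝ) < n := by exact_mod_cast hn
  set α := u / (n * K ^ 2) with hα
  have hα0 : 0 ≤ α := by positivity
  have hSm : Measurable fun ω => ∑ s ∈ Finset.range n, D s ω :=
    Finset.measurable_sum _ fun s _ => (hD s).mono (F.le _) le_rfl
  have h1 := lintegral_exp_sum_le F hD h α n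
  have h2 := mul_meas_ge_le_lintegral (μ := P) (f := fun ω =>
    ENNReal.ofReal (Real.exp (α * ∑ s ∈ Finset.range n, D s ω))) (by fun_prop)
    (ENNReal.ofReal (Real.exp (α * u)))
  have h3 : P {ω | u ≤ ∑ s ∈ Finset.range n, D s ω} ≤
      P {ω | ENNReal.ofReal (Real.exp (α * u)) ≤
        ENNReal.ofReal (Real.exp (α * ∑ s ∈ Finset.range n, D s ω))} := by
    refine measure_mono fun ω hω => ?_
    exact ENNReal.ofReal_le_ofReal (Real.exp_le_exp.2 (mul_le_mul_of_nonneg_left hω hα0))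
  refine h3.trans ?_
  have h4 : ENNReal.ofReal (Real.exp (-(α * u))) * ENNReal.ofReal (Real.exp (α * u)) = 1 := by
    rw [← ENNReal.ofReal_mul (Real.exp_pos _).le, ← Real.exp_add]
    simp
  calc _ = ENNReal.ofReal (Real.exp (-(α * u))) * (ENNReal.ofReal (Real.exp (α * u)) *
        P {ω | ENNReal.ofReal (Real.exp (α * u)) ≤
        ENNReal.ofReal (Real.exp (α * ∑ s ∈ Finset.range n, D s ω))}) := by
        rw [← mul_assoc, h4, one_mul]
    _ ≤ ENNReal.ofReal (Real.exp (-(α * u))) *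
        ENNReal.ofReal (Real.exp (n * (α ^ 2 * K ^ 2 / 2))) :=
        mul_le_mul_right (h2.trans h1) _
    _ = _ := by
        rw [← ENNReal.ofReal_mul (Real.exp_pos _).le, ← Real.exp_add]
        congr 2
        rw [hα]
        field_simp
        ring

/-- Azuma–Hoeffding inequality. -/
lemma measure_abs_ge_le_exp [IsProbabilityMeasure P] (F : Filtration ℕ mΩ) {D : ℕ → Ω → ℝ}
    (hD : ∀ s, Measurable[F (s + 1)] (D s)) (h : ∀ s, CondSubG (F s) P K (D s)) (hK : 0 < K)
    {n : ℕ} (hn : 1 ≤ n) {u : ℝ} (hu : 0 ≤ u) :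
    P {ω | u ≤ |∑ s ∈ Finset.range n, D s ω|} ≤
      ENNReal.ofReal (2 * Real.exp (-(u ^ 2 / (2 * n * K ^ 2)))) := by
  have h1 := measure_ge_le_exp F hD h hK hn hu
  have h2 := measure_ge_le_exp F (D := fun s ω => -D s ω) (fun s => (hD s).neg)
    (fun s => (h s).neg) hK hn hu
  have h3 : {ω | u ≤ |∑ s ∈ Finset.range n, D s ω|} ⊆
      {ω | u ≤ ∑ s ∈ Finset.range n, D s ω} ∪ {ω | u ≤ ∑ s ∈ Finset.range n, -D s ω} := by
    intro ω hω
    rcases le_abs.1 (show u ≤ |_| from hω) with h | h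
    · exact Or.inl h
    · refine Or.inr ?_
      simpa [Finset.sum_neg_distrib] using h
  refine (measure_mono h3).trans ((measure_union_le _ _).trans ((add_le_add h1 h2).trans ?_))
  rw [← ENNReal.ofReal_add (Real.exp_pos _).le (Real.exp_pos _).le, ← two_mul]

/-- Fubini for a variable `Z` independent of a σ-algebra `m` and an `m`-measurable `V`. -/
lemma lintegral_of_indep [IsProbabilityMeasure P] {E E' : Type*} [mE : MeasurableSpace E]
    [MeasurableSpace E'] (hm : m ≤ mΩ) {Z : Ω → E} (hZ : Measurable Z)
    (hind : Indep (MeasurableSpace.comap Z mE) m P) {V : Ω → E'} (hV : Measurable[m] V)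
    {f : E × E' → ENNReal} (hf : Measurable f) :
    ∫⁻ ω, f (Z ω, V ω) ∂P = ∫⁻ ω, ∫⁻ z, f (z, V ω) ∂(P.map Z) ∂P := by
  have hV' := hV.mono hm le_rfl
  have hind' : IndepFun Z V P := by
    rw [IndepFun_iff_Indep]
    exact indep_of_indep_of_le_right hind hV.comap_le
  have hprod := (indepFun_iff_map_prod_eq_prod_map_map hZ.aemeasurable hV'.aemeasurable).1 hind'
  have : IsProbabilityMeasure (P.map Z) := Measure.isProbabilityMeasure_map hZ.aemeasurable
  have : IsProbabilityMeasure (P.map V) := Measure.isProbabilityMeasure_map hV'.aemeasurable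
  rw [← lintegral_map (μ := P) (f := f) (g := fun ω => (Z ω, V ω)) hf (hZ.prodMk hV'), hprod,
    lintegral_prod_symm _ hf.aemeasurable,
    lintegral_map (f := fun v => ∫⁻ z, f (z, v) ∂(P.map Z)) hf.lintegral_prod_left' hV']

end Concentration

/-! ### Second moments of the greedy arm -/

section Greedy

variable {d : ℕ}

/-- The law of a fair coin. -/
noncomputable def coinLaw : Measure (Fin 2) := (1 / 2 : ENNReal) • Measure.count

/-- The joint law of the context and the coin of one round. -/
noncomputable def roundLaw (p : Context 2 d → ℝ) : Measure (Context 2 d × Fin 2) :=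
  (contextLaw p).prod coinLaw

/-- The expectation of `φ` at the feature of the greedy arm for the parameter `β`. -/
noncomputable def greedyMoment (p : Context 2 d → ℝ) (φ : Feature d → ℝ) (β : Feature d) : ℝ :=
  ∫ z, φ (z.1 (greedyArm z.1 β z.2)) ∂roundLaw p

instance : IsProbabilityMeasure coinLaw := by
  constructor
  simp [coinLaw, ENNReal.inv_mul_cancel]

lemma lintegral_coinLaw (f : Fin 2 → ENNReal) :
    ∫⁻ i, f i ∂coinLaw = 1 / 2 * ∑ i, f i := by
  rw [coinLaw, lintegral_smul_measure, lintegral_count, tsum_fintype, smul_eq_mul]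

instance (p : Context 2 d → ℝ) [IsProbabilityMeasure (contextLaw p)] :
    IsProbabilityMeasure (roundLaw p) := by
  unfold roundLaw
  infer_instance

lemma measurable_greedyArm :
    Measurable fun q : (Context 2 d × Fin 2) × Feature d => greedyArm q.1.1 q.2 q.1.2 := by
  have h : ∀ i : Fin 2, Measurable fun q : (Context 2 d × Fin 2) × Feature d =>
      (inner ℝ (q.1.1 i) q.2 : ℝ) := fun i => by fun_prop
  exact Measurable.ite (measurableSet_lt (h 1) (h 0)) measurable_const
    (Measurable.ite (measurableSet_lt (h 0) (h 1)) measurable_const (by fun_prop))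

lemma measurable_apply_fin {α E : Type*} {mα : MeasurableSpace α} [MeasurableSpace E]
    {f : α → Fin 2 → E} (hf : ∀ i, Measurable fun q => f q i) {a : α → Fin 2}
    (ha : Measurable a) : Measurable fun q => f q (a q) := by
  have : (fun q => f q (a q)) = fun q => if a q = 0 then f q 0 else f q 1 := by
    funext q
    split_ifs with h
    · rw [h]
    · rw [Fin.eq_one_of_ne_zero _ h]
  rw [this]
  exact Measurable.ite (ha (measurableSet_singleton 0)) (hf 0) (hf 1)

lemma measurable_greedyFeature :
    Measurable fun q : (Context 2 d × Fin 2) × Feature d =>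
      q.1.1 (greedyArm q.1.1 q.2 q.1.2) :=
  measurable_apply_fin (f := fun q : (Context 2 d × Fin 2) × Feature d => q.1.1)
    (fun i => by fun_prop) measurable_greedyArm

/-- Reflecting the context exchanges the two arms, so that the greedy choices for `x` and `-x`
together see both arms. A tie causes no trouble, as the coin is averaged out. -/
lemma sum_greedy_add_sum_greedy_neg (ψ : Feature d → ENNReal) (hψ : ∀ x, ψ (-x) = ψ x)
    (x : Context 2 d) (β : Feature d) :
    ∑ c, ψ (x (greedyArm x β c)) + ∑ c, ψ ((-x) (greedyArm (-x) β c))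
      = 2 * (ψ (x 0) + ψ (x 1)) := by
  rcases lt_trichotomy (inner ℝ (x 0) β : ℝ) (inner ℝ (x 1) β) with h | h | h
  · have h' := h.not_gt
    simp [greedyArm, h, h', hψ]
    ring
  · simp [greedyArm, h, hψ]
    ring
  · have h' := h.not_gt
    simp [greedyArm, h, h', hψ]
    ring

lemma lintegral_neg_contextLaw_le {p : Context 2 d → ℝ} (hp : Measurable p) (hp0 : ∀ x, 0 ≤ p x)
    {ν : ℝ} (hν : RelaxedSymmetry p ν) {g : Context 2 d → ENNReal} (hg : Measurable g) :
    ∫⁻ x, g (-x) ∂contextLaw p ≤ ENNReal.ofReal ν * ∫⁻ x, g x ∂contextLaw p := by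
  have hpm : Measurable fun x => ENNReal.ofReal (p x) := by fun_prop
  have hgn : Measurable fun x : Context 2 d => g (-x) := hg.comp measurable_neg
  have hfm : Measurable fun x : Context 2 d => ENNReal.ofReal (p (-x)) * g x :=
    (hpm.comp measurable_neg).mul hg
  unfold contextLaw
  rw [lintegral_withDensity_eq_lintegral_mul _ hpm hgn,
    lintegral_withDensity_eq_lintegral_mul _ hpm hg, ← lintegral_const_mul _ (hpm.mul hg)]
  have hinv : (volume : Measure (Context 2 d)).IsNegInvariant := Measure.pi.isNegInvariant _
  have h1 := (Measure.measurePreserving_neg (volume : Measure (Context 2 d))).lintegral_comp hfm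
  simp only [neg_neg] at h1
  simp only [Pi.mul_apply]
  rw [h1]
  refine lintegral_mono_ae ?_
  filter_upwards [hν] with x hx
  rw [← mul_assoc, ← ENNReal.ofReal_mul' (hp0 x)]
  gcongr

lemma one_le_of_relaxedSymmetry {p : Context 2 d → ℝ} [IsProbabilityMeasure (contextLaw p)]
    (hp : Measurable p) (hp0 : ∀ x, 0 ≤ p x) {ν : ℝ} (hν : RelaxedSymmetry p ν) : 1 ≤ ν := by
  have h := lintegral_neg_contextLaw_le hp hp0 hν (g := fun _ => 1) measurable_const
  simp only [lintegral_const, measure_univ, mul_one] at h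
  exact ENNReal.one_le_ofReal.1 h

/-- Under relaxed symmetry, the greedy arm carries a `1 / (1 + ν)` share of the moments of both
arms, whatever the parameter is. -/
lemma lintegral_add_le_greedy {p : Context 2 d → ℝ} [IsProbabilityMeasure (contextLaw p)]
    (hp : Measurable p) (hp0 : ∀ x, 0 ≤ p x) {ν : ℝ} (hν : RelaxedSymmetry p ν)
    {ψ : Feature d → ENNReal} (hψm : Measurable ψ) (hψ : ∀ x, ψ (-x) = ψ x) (β : Feature d) :
    ∫⁻ x, (ψ (x 0) + ψ (x 1)) ∂contextLaw p
      ≤ (1 + ENNReal.ofReal ν) * ∫⁻ z, ψ (z.1 (greedyArm z.1 β z.2)) ∂roundLaw p := by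
  have hm : Measurable fun z : Context 2 d × Fin 2 => ψ (z.1 (greedyArm z.1 β z.2)) :=
    hψm.comp (measurable_greedyFeature.comp (measurable_id.prodMk measurable_const))
  set g : Context 2 d → ENNReal := fun x => 1 / 2 * ∑ c, ψ (x (greedyArm x β c)) with hg
  have hgm : Measurable g :=
    (Finset.measurable_sum _ fun c _ =>
      hm.comp (measurable_id.prodMk (measurable_const (a := c)))).const_mul _
  have h1 : ∫⁻ z, ψ (z.1 (greedyArm z.1 β z.2)) ∂roundLaw p = ∫⁻ x, g x ∂contextLaw p := by
    rw [roundLaw, lintegral_prod _ hm.aemeasurable]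
    simp only [lintegral_coinLaw, hg]
  have h2 : ∀ x : Context 2 d, ψ (x 0) + ψ (x 1) = g x + g (-x) := by
    intro x
    have h := sum_greedy_add_sum_greedy_neg ψ hψ x β
    simp only [hg]
    rw [← mul_add, h, ← mul_assoc, one_div,
      ENNReal.inv_mul_cancel two_ne_zero ENNReal.ofNat_ne_top, one_mul]
  simp_rw [h2]
  rw [lintegral_add_left hgm, h1, add_mul, one_mul]
  exact add_le_add le_rfl (lintegral_neg_contextLaw_le hp hp0 hν hgm)

variable {p : Context 2 d → ℝ} {xmax : ℝ}

lemma ae_roundLaw_norm_le [IsProbabilityMeasure (contextLaw p)]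
    (hX : ∀ᵐ x ∂contextLaw p, ∀ i, ‖x i‖ ≤ xmax) :
    ∀ᵐ z ∂roundLaw p, ∀ i, ‖z.1 i‖ ≤ xmax :=
  Measure.quasiMeasurePreserving_fst.ae hX

lemma integrable_greedy [IsProbabilityMeasure (contextLaw p)]
    (hX : ∀ᵐ x ∂contextLaw p, ∀ i, ‖x i‖ ≤ xmax) {φ : Feature d → ℝ} (hφ : Measurable φ) {B : ℝ}
    (hB : ∀ x, ‖x‖ ≤ xmax → |φ x| ≤ B) (β : Feature d) :
    Integrable (fun z => φ (z.1 (greedyArm z.1 β z.2))) (roundLaw p) := by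
  have hm : Measurable fun z : Context 2 d × Fin 2 => φ (z.1 (greedyArm z.1 β z.2)) :=
    hφ.comp (measurable_greedyFeature.comp (measurable_id.prodMk measurable_const))
  refine Integrable.of_bound hm.aestronglyMeasurable B ?_
  filter_upwards [ae_roundLaw_norm_le hX] with z hz
  exact hB _ (hz _)

lemma abs_greedyMoment_le [IsProbabilityMeasure (contextLaw p)]
    (hX : ∀ᵐ x ∂contextLaw p, ∀ i, ‖x i‖ ≤ xmax) {φ : Feature d → ℝ} {B : ℝ}
    (hB : ∀ x, ‖x‖ ≤ xmax → |φ x| ≤ B) (β : Feature d) : |greedyMoment p φ β| ≤ B := by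
  have h := norm_integral_le_of_norm_le_const (μ := roundLaw p) (C := B)
    (f := fun z => φ (z.1 (greedyArm z.1 β z.2))) (by
      filter_upwards [ae_roundLaw_norm_le hX] with z hz
      exact hB _ (hz _))
  simpa [greedyMoment] using h

lemma measurable_greedyMoment [IsProbabilityMeasure (contextLaw p)] {φ : Feature d → ℝ}
    (hφ : Measurable φ) : Measurable (greedyMoment p φ) := by
  have h : StronglyMeasurable fun q : (Context 2 d × Fin 2) × Feature d =>
      φ (q.1.1 (greedyArm q.1.1 q.2 q.1.2)) :=
    (hφ.comp measurable_greedyFeature).stronglyMeasurable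
  exact h.integral_prod_left'.measurable

lemma abs_apply_le_norm (x : Feature d) (i : Fin d) : |x i| ≤ ‖x‖ := by
  simpa using PiLp.norm_apply_le x i

lemma abs_apply_mul_apply_le {x : Feature d} (hx : ‖x‖ ≤ xmax) (i j : Fin d) :
    |x i * x j| ≤ xmax ^ 2 := by
  rw [abs_mul, sq]
  exact mul_le_mul ((abs_apply_le_norm x i).trans hx) ((abs_apply_le_norm x j).trans hx)
    (abs_nonneg _) ((norm_nonneg x).trans hx)

lemma quadratic_greedyMoment [IsProbabilityMeasure (contextLaw p)]
    (hX : ∀ᵐ x ∂contextLaw p, ∀ i, ‖x i‖ ≤ xmax) (v β : Feature d) :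
    ∑ i, ∑ j, v i * v j * greedyMoment p (fun x => x i * x j) β
      = greedyMoment p (fun x => inner ℝ x v ^ 2) β := by
  have hint : ∀ i j, Integrable (fun z : Context 2 d × Fin 2 => v i * v j *
      (z.1 (greedyArm z.1 β z.2) i * z.1 (greedyArm z.1 β z.2) j)) (roundLaw p) := fun i j =>
    (integrable_greedy hX (φ := fun x => x i * x j) (by fun_prop)
      (fun x hx => abs_apply_mul_apply_le hx i j) β).const_mul _
  simp only [greedyMoment, sq_inner_eq_sum]
  rw [integral_finsetSum _ fun i _ => integrable_finsetSum _ fun j _ => hint i j]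
  refine Finset.sum_congr rfl fun i _ => ?_
  rw [integral_finsetSum _ fun j _ => hint i j]
  exact Finset.sum_congr rfl fun j _ => (integral_const_mul _ _).symm

lemma quadratic_gram [IsProbabilityMeasure (contextLaw p)]
    (hX : ∀ᵐ x ∂contextLaw p, ∀ i, ‖x i‖ ≤ xmax) (v : Feature d) :
    v.ofLp ⬝ᵥ (gram (contextLaw p) *ᵥ v.ofLp)
      = 1 / 2 * ∫ x, (inner ℝ (x 0) v ^ 2 + inner ℝ (x 1) v ^ 2) ∂contextLaw p := by
  have hint : ∀ i j, Integrable (fun x : Context 2 d => v i * v j *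
      (x 0 i * x 0 j + x 1 i * x 1 j)) (contextLaw p) := by
    intro i j
    refine Integrable.const_mul (Integrable.of_bound (by fun_prop) (xmax ^ 2 + xmax ^ 2) ?_) _
    filter_upwards [hX] with x hx
    exact (abs_add_le _ _).trans (add_le_add (abs_apply_mul_apply_le (hx 0) i j)
      (abs_apply_mul_apply_le (hx 1) i j))
  simp only [sq_inner_eq_sum, ← Finset.sum_add_distrib, ← mul_add]
  rw [integral_finsetSum _ fun i _ => integrable_finsetSum _ fun j _ => hint i j,
    Finset.mul_sum]
  simp only [dotProduct, Matrix.mulVec, gram, Matrix.of_apply, Fin.sum_univ_two]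
  refine Finset.sum_congr rfl fun i _ => ?_
  rw [integral_finsetSum _ fun j _ => hint i j, Finset.mul_sum, Finset.mul_sum]
  refine Finset.sum_congr rfl fun j _ => ?_
  rw [integral_const_mul]
  push_cast
  ring

/-- The restricted eigenvalue condition passes from the theoretical Gram matrix to the second
moments of the greedy arm, uniformly in the parameter that drives the greedy choice. -/
lemma restricted_eigenvalue_greedy [IsProbabilityMeasure (contextLaw p)]
    (hp : Measurable p) (hp0 : ∀ x, 0 ≤ p x) {ν : ℝ} (hν : RelaxedSymmetry p ν)
    (hX : ∀ᵐ x ∂contextLaw p, ∀ i, ‖x i‖ ≤ xmax) {S : Finset (Fin d)} {φ1 : ℝ}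
    (hRE : RECondition (gram (contextLaw p)) S φ1) {v : Feature d} (hv : v ∈ cone S)
    (β : Feature d) :
    φ1 ^ 2 / ν * ‖v‖ ^ 2 ≤ ∑ i, ∑ j, v i * v j * greedyMoment p (fun x => x i * x j) β := by
  have hν1 : 1 ≤ ν := one_le_of_relaxedSymmetry hp hp0 hν
  have h1 := hRE v hv
  rw [quadratic_gram hX] at h1
  rw [quadratic_greedyMoment hX]
  have hb : ∀ x : Feature d, ‖x‖ ≤ xmax → |inner ℝ x v ^ 2| ≤ (xmax * ‖v‖) ^ 2 := by
    intro x hx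
    rw [abs_of_nonneg (sq_nonneg _), ← sq_abs]
    exact pow_le_pow_left₀ (abs_nonneg _) ((abs_real_inner_le_norm x v).trans
      (mul_le_mul_of_nonneg_right hx (norm_nonneg v))) 2
  have hint : Integrable (fun x : Context 2 d => inner ℝ (x 0) v ^ 2 + inner ℝ (x 1) v ^ 2)
      (contextLaw p) := by
    refine Integrable.of_bound (by fun_prop) ((xmax * ‖v‖) ^ 2 + (xmax * ‖v‖) ^ 2) ?_
    filter_upwards [hX] with x hx
    exact (abs_add_le _ _).trans (add_le_add (hb _ (hx 0)) (hb _ (hx 1)))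
  have h2 := lintegral_add_le_greedy hp hp0 hν
    (ψ := fun x => ENNReal.ofReal (inner ℝ x v ^ 2)) (by fun_prop) (by simp) β
  simp_rw [← ENNReal.ofReal_add (sq_nonneg _) (sq_nonneg _)] at h2
  rw [← ofReal_integral_eq_lintegral_ofReal hint
      (Filter.Eventually.of_forall fun x => by positivity),
    ← ofReal_integral_eq_lintegral_ofReal (integrable_greedy hX (by fun_prop) hb β)
      (Filter.Eventually.of_forall fun x => sq_nonneg _), ← ENNReal.ofReal_one,
    ← ENNReal.ofReal_add zero_le_one (by linarith), ← ENNReal.ofReal_mul (by linarith)] at h2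
  have hq0 : 0 ≤ greedyMoment p (fun x => inner ℝ x v ^ 2) β :=
    integral_nonneg fun z => sq_nonneg _
  have h3 := (ENNReal.ofReal_le_ofReal_iff (mul_nonneg (by linarith) hq0)).1 h2
  rw [div_mul_eq_mul_div, div_le_iff₀ (by linarith)]
  change _ ≤ (1 + ν) * greedyMoment p (fun x => inner ℝ x v ^ 2) β at h3
  nlinarith

end Greedy

/-! ### Concentration along the rounds of the bandit -/

section Rounds

variable {Ω : Type*} {mΩ : MeasurableSpace Ω} {P : Measure Ω} {d : ℕ}
  {F : Filtration ℕ mΩ} {p : Context 2 d → ℝ} {σ : ℝ} {X : ℕ → Ω → Context 2 d}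
  {c : ℕ → Ω → Fin 2} {ε : ℕ → Fin 2 → Ω → ℝ} {βhat : ℕ → Ω → Feature d} {xmax : ℝ}

lemma measurable_pulledArm {m : MeasurableSpace Ω} {t : ℕ} (hX : Measurable[m] (X t))
    (hc : Measurable[m] (c t)) (hβ : Measurable[m] (βhat t)) :
    Measurable[m] (pulledArm X c βhat t) :=
  measurable_greedyArm.comp ((hX.prodMk hc).prodMk hβ)

lemma measurable_pulledFeature {m : MeasurableSpace Ω} {t : ℕ} (hX : Measurable[m] (X t))
    (hc : Measurable[m] (c t)) (hβ : Measurable[m] (βhat t)) :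
    Measurable[m] fun ω => X t ω (pulledArm X c βhat t ω) :=
  measurable_greedyFeature.comp ((hX.prodMk hc).prodMk hβ)

lemma IsEnvironment.isProbabilityMeasure_contextLaw [IsProbabilityMeasure P]
    (henv : IsEnvironment P F p σ X c ε) : IsProbabilityMeasure (contextLaw p) := by
  rw [← henv.context_law 0]
  exact Measure.isProbabilityMeasure_map
    ((henv.measurable_context 0).mono (F.le _) le_rfl).aemeasurable

lemma IsEnvironment.map_coin (henv : IsEnvironment P F p σ X c ε) (t : ℕ) :
    P.map (c (t + 1)) = coinLaw := by
  refine Measure.ext_of_singleton fun i => ?_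
  rw [Measure.map_apply ((henv.measurable_coin t).mono (F.le _) le_rfl)
    (measurableSet_singleton i)]
  have : c (t + 1) ⁻¹' {i} = {ω | c (t + 1) ω = i} := rfl
  rw [this, henv.coin_law t i]
  simp [coinLaw]

lemma IsEnvironment.map_round [IsProbabilityMeasure P] (henv : IsEnvironment P F p σ X c ε)
    (t : ℕ) : P.map (fun ω => (X (t + 1) ω, c (t + 1) ω)) = roundLaw p := by
  rw [(indepFun_iff_map_prod_eq_prod_map_map
    ((henv.measurable_context t).mono (F.le _) le_rfl).aemeasurable
    ((henv.measurable_coin t).mono (F.le _) le_rfl).aemeasurable).1 (henv.context_indep_coin t),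
    henv.context_law t, henv.map_coin t, roundLaw]

lemma IsEnvironment.ae_norm_le (henv : IsEnvironment P F p σ X c ε)
    (hX : ∀ᵐ x ∂contextLaw p, ∀ i, ‖x i‖ ≤ xmax) (t : ℕ) :
    ∀ᵐ ω ∂P, ∀ i, ‖X (t + 1) ω i‖ ≤ xmax := by
  rw [← henv.context_law t] at hX
  exact ae_of_ae_map ((henv.measurable_context t).mono (F.le _) le_rfl).aemeasurable hX

/-- Given the past, `φ` at the pulled feature has mean `greedyMoment p φ` at the current
estimate. The shift by `2 * B` keeps the integrand nonnegative. -/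
lemma IsEnvironment.lintegral_greedy [IsProbabilityMeasure P]
    (henv : IsEnvironment P F p σ X c ε)
    (hX : ∀ᵐ x ∂contextLaw p, ∀ i, ‖x i‖ ≤ xmax) {t : ℕ} (hβ : Measurable[F t] (βhat (t + 1)))
    {φ : Feature d → ℝ} (hφ : Measurable φ) {B : ℝ} (hB : ∀ x, ‖x‖ ≤ xmax → |φ x| ≤ B)
    {W : Ω → ENNReal} (hW : Measurable[F t] W) :
    ∫⁻ ω, W ω * ENNReal.ofReal (2 * B + (φ (X (t + 1) ω (pulledArm X c βhat (t + 1) ω))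
        - greedyMoment p φ (βhat (t + 1) ω))) ∂P
      = ENNReal.ofReal (2 * B) * ∫⁻ ω, W ω ∂P := by
  have := henv.isProbabilityMeasure_contextLaw
  set Z : Ω → Context 2 d × Fin 2 := fun ω => (X (t + 1) ω, c (t + 1) ω) with hZ
  have hZm : Measurable Z := ((henv.measurable_context t).mono (F.le _) le_rfl).prodMk
    ((henv.measurable_coin t).mono (F.le _) le_rfl)
  set f : (Context 2 d × Fin 2) × (ENNReal × Feature d) → ENNReal := fun q =>
    q.2.1 * ENNReal.ofReal (2 * B + (φ (q.1.1 (greedyArm q.1.1 q.2.2 q.1.2))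
      - greedyMoment p φ q.2.2)) with hf
  have hgreedy : Measurable fun q : (Context 2 d × Fin 2) × (ENNReal × Feature d) =>
      φ (q.1.1 (greedyArm q.1.1 q.2.2 q.1.2)) :=
    hφ.comp (measurable_greedyFeature.comp
      (measurable_fst.prodMk (measurable_snd.comp measurable_snd)))
  have hmom : Measurable fun q : (Context 2 d × Fin 2) × (ENNReal × Feature d) =>
      greedyMoment p φ q.2.2 :=
    (measurable_greedyMoment hφ).comp (measurable_snd.comp measurable_snd)
  have hfm : Measurable f := (measurable_fst.comp measurable_snd).mul
    ((hgreedy.sub hmom).const_add (2 * B)).ennreal_ofReal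
  have h1 := lintegral_of_indep (F.le t) hZm (henv.indep_past t) (hW.prodMk hβ) hfm
  rw [henv.map_round t] at h1
  have h2 : ∀ (w : ENNReal) (β : Feature d), ∫⁻ z, f (z, (w, β)) ∂roundLaw p
      = w * ENNReal.ofReal (2 * B) := by
    intro w β
    have hgm : Measurable fun z : Context 2 d × Fin 2 => ENNReal.ofReal
        (2 * B + (φ (z.1 (greedyArm z.1 β z.2)) - greedyMoment p φ β)) :=
      (((hφ.comp (measurable_greedyFeature.comp
        (measurable_id.prodMk measurable_const))).sub_const _).const_add _).ennreal_ofReal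
    have hint := integrable_greedy hX hφ hB β
    have hint' : Integrable (fun z => φ (z.1 (greedyArm z.1 β z.2)) - greedyMoment p φ β)
        (roundLaw p) := hint.sub (integrable_const _)
    simp only [hf]
    rw [lintegral_const_mul _ hgm, ← ofReal_integral_eq_lintegral_ofReal]
    · rw [integral_add (integrable_const _) hint',
        integral_sub hint (integrable_const _)]
      simp [greedyMoment]
    · exact (integrable_const _).add hint'
    · filter_upwards [ae_roundLaw_norm_le hX] with z hz
      have e1 := (abs_le.1 (hB _ (hz (greedyArm z.1 β z.2)))).1
      have e2 := (abs_le.1 (abs_greedyMoment_le hX hB β)).2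
      change (0 : ℝ) ≤ _
      linarith
  calc _ = ∫⁻ ω, f (Z ω, (W ω, βhat (t + 1) ω)) ∂P := rfl
    _ = _ := by
      rw [h1]
      simp_rw [h2]
      rw [lintegral_mul_const _ (hW.mono (F.le t) le_rfl), mul_comm]

/-- The fluctuation of a bounded function of the pulled feature is conditionally
sub-Gaussian. -/
lemma IsEnvironment.condSubG_greedy [IsProbabilityMeasure P]
    (henv : IsEnvironment P F p σ X c ε)
    (hX : ∀ᵐ x ∂contextLaw p, ∀ i, ‖x i‖ ≤ xmax) {t : ℕ} (hβ : Measurable[F t] (βhat (t + 1)))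
    {φ : Feature d → ℝ} (hφ : Measurable φ) {B : ℝ} (hB0 : 0 < B)
    (hB : ∀ x, ‖x‖ ≤ xmax → |φ x| ≤ B) :
    CondSubG (F t) P (2 * B) (fun ω => φ (X (t + 1) ω (pulledArm X c βhat (t + 1) ω))
        - greedyMoment p φ (βhat (t + 1) ω)) := by
  have := henv.isProbabilityMeasure_contextLaw
  have hβ' := hβ.mono (F.le t) le_rfl
  refine CondSubG.of_abs_le (F.le t) ?_ (by positivity) ?_ ?_ ?_
  · exact (hφ.comp (measurable_pulledFeature
      ((henv.measurable_context t).mono (F.le _) le_rfl)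
      ((henv.measurable_coin t).mono (F.le _) le_rfl) hβ')).sub
      ((measurable_greedyMoment hφ).comp hβ')
  · filter_upwards [henv.ae_norm_le hX t] with ω hω
    have e1 := hB _ (hω (pulledArm X c βhat (t + 1) ω))
    have e2 := abs_greedyMoment_le hX hB (βhat (t + 1) ω)
    refine (abs_sub _ _).trans ?_
    linarith
  · exact fun W hW => henv.lintegral_greedy hX hβ hφ hB hW
  · intro W hW
    have h := henv.lintegral_greedy hX hβ (φ := fun x => -φ x) hφ.neg
      (fun x hx => by rw [abs_neg]; exact hB x hx) hW
    have hneg : ∀ β, greedyMoment p (fun x => -φ x) β = -greedyMoment p φ β := fun β =>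
      integral_neg _
    rw [← h]
    refine lintegral_congr fun ω => ?_
    rw [hneg]
    congr 2
    ring

/-- The noise of the pulled arm, weighted by a coordinate of its feature, is conditionally
sub-Gaussian. -/
lemma IsEnvironment.condSubG_noise [IsProbabilityMeasure P]
    (henv : IsEnvironment P F p σ X c ε)
    (hX : ∀ᵐ x ∂contextLaw p, ∀ i, ‖x i‖ ≤ xmax) (hxmax : 0 < xmax) {t : ℕ}
    (hβ : Measurable[F t] (βhat (t + 1))) (j : Fin d) :
    CondSubG (F t) P (σ * xmax) (fun ω => ε (t + 1) (pulledArm X c βhat (t + 1) ω) ω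
        * X (t + 1) ω (pulledArm X c βhat (t + 1) ω) j) := by
  have hZ : Measurable fun ω => (X (t + 1) ω, c (t + 1) ω) :=
    ((henv.measurable_context t).mono (F.le _) le_rfl).prodMk
      ((henv.measurable_coin t).mono (F.le _) le_rfl)
  have hG : preRewardInfo F X c t ≤ mΩ := sup_le (F.le t) hZ.comap_le
  have hZG : Measurable[preRewardInfo F X c t] fun ω => (X (t + 1) ω, c (t + 1) ω) :=
    (comap_measurable _).mono le_sup_right le_rfl
  have hXG : Measurable[preRewardInfo F X c t] (X (t + 1)) := measurable_fst.comp hZG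
  have hcG : Measurable[preRewardInfo F X c t] (c (t + 1)) := measurable_snd.comp hZG
  have hβG : Measurable[preRewardInfo F X c t] (βhat (t + 1)) := hβ.mono le_sup_left le_rfl
  have hεm : ∀ i, Measurable (ε (t + 1) i) := fun i =>
    (henv.measurable_noise t i).mono (F.le _) le_rfl
  have hcoord : ∀ i, Measurable[preRewardInfo F X c t] fun ω => X (t + 1) ω i j := fun i =>
    (show Measurable fun x : Context 2 d => x i j by fun_prop).comp hXG
  have h : ∀ i, CondSubG (preRewardInfo F X c t) P (σ * xmax)
      (fun ω => ε (t + 1) i ω * X (t + 1) ω i j) := fun i =>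
    (CondSubG.of_condExp hG (hεm i) (henv.noise_exp_integrable t i)
      (henv.noise_subgaussian t i)).mul_of_abs_le hG (hεm i) (hcoord i) hxmax (by
        filter_upwards [henv.ae_norm_le hX t] with ω hω
        exact (abs_apply_le_norm _ j).trans (hω i))
  exact (CondSubG.select hG h (fun i => (hεm i).mul ((hcoord i).mono hG le_rfl))
    (measurable_pulledArm hXG hcG hβG)).mono le_sup_left

/-- Tail bound for the noise, at the level `λ_n / 2` where the Lasso penalty dominates it. -/
lemma IsEnvironment.measure_noise_le [IsProbabilityMeasure P]
    (henv : IsEnvironment P F p σ X c ε) (hσ : 0 < σ) (hd : 1 ≤ d)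
    (hX : ∀ᵐ x ∂contextLaw p, ∀ i, ‖x i‖ ≤ xmax) (hxmax : 0 < xmax)
    (hβ : ∀ t, Measurable[F t] (βhat (t + 1))) {n : ℕ} (hn : 1 ≤ n) (j : Fin d) :
    P {ω | n * (penalty (2 * σ * xmax) d n / 2) ≤ |∑ s ∈ Finset.range n,
        ε (s + 1) (pulledArm X c βhat (s + 1) ω) ω
          * X (s + 1) ω (pulledArm X c βhat (s + 1) ω) j|}
      ≤ ENNReal.ofReal (2 / (n ^ 2 * d)) := by
  have hn0 : (0 : ℝ) < n := by exact_mod_cast hn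
  have hd0 : (0 : ℝ) < d := by exact_mod_cast hd
  have hlogn : 0 ≤ Real.log n := Real.log_natCast_nonneg n
  have hlogd : 0 ≤ Real.log d := Real.log_natCast_nonneg d
  have hpen : 0 ≤ penalty (2 * σ * xmax) d n := by unfold penalty; positivity
  refine (measure_abs_ge_le_exp F (K := σ * xmax) (fun s => ?_)
    (fun s => henv.condSubG_noise hX hxmax (hβ s) j) (by positivity) hn (by positivity)).trans ?_
  · have hXm := henv.measurable_context s
    have hcm := henv.measurable_coin s
    have hβm := (hβ s).mono (F.mono (Nat.le_succ s)) le_rfl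
    refine Measurable.mul ?_ ?_
    · exact measurable_apply_fin (f := fun ω i => ε (s + 1) i ω) (henv.measurable_noise s)
        (measurable_pulledArm hXm hcm hβm)
    · exact (show Measurable fun x : Feature d => x j by fun_prop).comp
        (measurable_pulledFeature hXm hcm hβm)
  · refine ENNReal.ofReal_le_ofReal (le_of_eq ?_)
    have h1 : (n * (penalty (2 * σ * xmax) d n / 2)) ^ 2 / (2 * n * (σ * xmax) ^ 2)
        = Real.log (n ^ 2 * d) := by
      have h2 : penalty (2 * σ * xmax) d n ^ 2
          = (2 * σ * xmax) ^ 2 * ((4 * Real.log n + 2 * Real.log d) / n) := by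
        rw [penalty, mul_pow, Real.sq_sqrt (by positivity)]
      rw [mul_pow, div_pow, h2, Real.log_mul (by positivity) (by positivity), Real.log_pow]
      push_cast
      field_simp
      ring
    rw [h1, Real.exp_neg, Real.exp_log (by positivity)]
    rfl

/-- Tail bound for an entry of the empirical Gram matrix of the pulled features. With `C = C2`,
the deviation `8 * C * xmax ^ 2` is at most `φ₁² / (32 s₀ ν)`, as `lasso_error_le` requires. -/
lemma IsEnvironment.measure_gram_le [IsProbabilityMeasure P]
    (henv : IsEnvironment P F p σ X c ε)
    (hX : ∀ᵐ x ∂contextLaw p, ∀ i, ‖x i‖ ≤ xmax) (hxmax : 0 < xmax)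
    (hβ : ∀ t, Measurable[F t] (βhat (t + 1))) {n : ℕ} (hn : 1 ≤ n) {C : ℝ} (hC : 0 ≤ C)
    (i j : Fin d) :
    P {ω | n * (8 * C * xmax ^ 2) ≤ |∑ s ∈ Finset.range n,
        (X (s + 1) ω (pulledArm X c βhat (s + 1) ω) i
          * X (s + 1) ω (pulledArm X c βhat (s + 1) ω) j
          - greedyMoment p (fun x => x i * x j) (βhat (s + 1) ω))|}
      ≤ ENNReal.ofReal (2 * Real.exp (-(8 * C ^ 2 * n))) := by
  have := henv.isProbabilityMeasure_contextLaw
  have hn0 : (0 : ℝ) < n := by exact_mod_cast hn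
  have hφ : Measurable fun x : Feature d => x i * x j := by fun_prop
  refine (measure_abs_ge_le_exp F (K := 2 * xmax ^ 2) (fun s => ?_)
    (fun s => henv.condSubG_greedy hX (hβ s) hφ (by positivity)
      fun x hx => abs_apply_mul_apply_le hx i j) (by positivity) hn (by positivity)).trans ?_
  · have hβm := (hβ s).mono (F.mono (Nat.le_succ s)) le_rfl
    exact (hφ.comp (measurable_pulledFeature (henv.measurable_context s)
      (henv.measurable_coin s) hβm)).sub ((measurable_greedyMoment hφ).comp hβm)
  · refine ENNReal.ofReal_le_ofReal (le_of_eq ?_)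
    congr 3
    field_simp
    ring

end Rounds

/-! ### Sums over the rounds -/

section Sums

lemma sum_inv_sqrt_le (T : ℕ) :
    ∑ n ∈ Finset.range (T + 1), 1 / Real.sqrt n ≤ 2 * Real.sqrt T := by
  induction T with
  | zero => simp
  | succ T ih =>
    rw [Finset.sum_range_succ]
    have h1 : (0 : ℝ) < Real.sqrt ((T + 1 : ℕ) : ℝ) := Real.sqrt_pos.2 (by positivity)
    have h2 : Real.sqrt ((T + 1 : ℕ) : ℝ) ^ 2 = T + 1 := by
      rw [Real.sq_sqrt (by positivity)]; push_cast; ring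
    have h3 : Real.sqrt (T : ℝ) ^ 2 = T := Real.sq_sqrt (by positivity)
    have h4 : 1 / Real.sqrt ((T + 1 : ℕ) : ℝ)
        ≤ 2 * (Real.sqrt ((T + 1 : ℕ) : ℝ) - Real.sqrt T) := by
      rw [div_le_iff₀ h1]
      nlinarith [sq_nonneg (Real.sqrt ((T + 1 : ℕ) : ℝ) - Real.sqrt T)]
    linarith

lemma sum_inv_sq_le (T : ℕ) : ∑ n ∈ Finset.range T, 2 / (n : ℝ) ^ 2 ≤ 4 := by
  have h : ∀ T : ℕ, ∑ n ∈ Finset.range (T + 2), 2 / (n : ℝ) ^ 2 ≤ 4 - 2 / ((T : ℝ) + 1) := by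
    intro T
    induction T with
    | zero => norm_num [Finset.sum_range_succ]
    | succ T ih =>
      rw [show T + 1 + 2 = (T + 2) + 1 from rfl, Finset.sum_range_succ]
      have : 2 / ((T + 2 : ℕ) : ℝ) ^ 2 ≤ 2 / ((T : ℝ) + 1) - 2 / ((T + 1 : ℕ) + 1) := by
        push_cast
        rw [div_sub_div _ _ (by positivity) (by positivity), div_le_div_iff₀ (by positivity)
          (by positivity)]
        have : (0 : ℝ) ≤ T := Nat.cast_nonneg T
        nlinarith
      linarith
  refine (Finset.sum_le_sum_of_subset_of_nonneg (t := Finset.range (T + 2))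
    (Finset.range_subset_range.2 (by omega)) fun n _ _ => by positivity).trans ((h T).trans ?_)
  have : (0 : ℝ) ≤ 2 / (T + 1) := by positivity
  linarith

/-- The sum of the trivial bound `1` up to `n ≈ L / y` and of a geometric series beyond. -/
lemma sum_min_one_exp_le {L y : ℝ} (hL : 0 ≤ L) (hy : 0 < y) (T : ℕ) :
    ∑ n ∈ Finset.range T, min 1 (Real.exp (L - y * n)) ≤ (L + 1) / y + 2 := by
  set N := ⌈L / y⌉₊ with hN
  have hN1 : L / y ≤ N := Nat.le_ceil _
  have hN2 : (N : ℝ) < L / y + 1 := Nat.ceil_lt_add_one (by positivity)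
  set r := Real.exp (-y) with hr
  have hr0 : 0 < r := Real.exp_pos _
  have hr1 : r < 1 := by rw [hr, Real.exp_lt_one_iff]; linarith
  have hnn : ∀ n : ℕ, 0 ≤ min 1 (Real.exp (L - y * n)) := fun n =>
    le_min zero_le_one (Real.exp_pos _).le
  have hgeom : ∑ k ∈ Finset.range T, r ^ k ≤ 1 / y + 1 := by
    have h1 := geom_sum_mul_neg r T
    have h2 : r * (1 + y) ≤ 1 := by
      have h3 := Real.add_one_le_exp y
      have h4 : r * Real.exp y = 1 := by rw [hr, ← Real.exp_add]; simp
      nlinarith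
    have h5 : y ≤ (1 + y) * (1 - r) := by nlinarith
    have h6 : (∑ k ∈ Finset.range T, r ^ k) * (1 - r) ≤ 1 := by
      rw [h1]; linarith [pow_pos hr0 T]
    have h7 : 1 / y + 1 = (1 + y) / y := by field_simp
    rw [h7, le_div_iff₀ hy]
    have hs : 0 ≤ ∑ k ∈ Finset.range T, r ^ k := Finset.sum_nonneg fun k _ => by positivity
    nlinarith
  have hsplit : ∑ n ∈ Finset.range T, min 1 (Real.exp (L - y * n)) ≤
      ∑ n ∈ Finset.range N, (1 : ℝ) + ∑ k ∈ Finset.range T, r ^ k := by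
    refine (Finset.sum_le_sum_of_subset_of_nonneg (t := Finset.range (N + T))
      (Finset.range_subset_range.2 (by omega)) fun n _ _ => hnn n).trans ?_
    rw [Finset.sum_range_add]
    refine add_le_add (Finset.sum_le_sum fun n _ => min_le_left _ _)
      (Finset.sum_le_sum fun k _ => (min_le_right _ _).trans ?_)
    rw [hr, ← Real.exp_nat_mul]
    refine Real.exp_le_exp.2 ?_
    rw [div_le_iff₀ hy] at hN1
    push_cast
    linarith
  rw [Finset.sum_const, Finset.card_range, nsmul_eq_mul, mul_one] at hsplit
  have : (L + 1) / y + 2 = (L / y + 1) + (1 / y + 1) := by ring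
  linarith

lemma sum_penalty_rate_le {d T : ℕ} (hd : 1 ≤ d) (hT : 1 ≤ T) :
    ∑ n ∈ Finset.range T, Real.sqrt ((4 * Real.log n + 2 * Real.log d) / n)
      ≤ 4 * Real.sqrt (T * Real.log (d * T)) := by
  obtain ⟨T, rfl⟩ := Nat.exists_eq_add_of_le' hT
  have hd0 : (0 : ℝ) < d := by exact_mod_cast hd
  have hT0 : (0 : ℝ) < ((T + 1 : ℕ) : ℝ) := by positivity
  set ℓ := Real.log (d * (T + 1 : ℕ)) with hℓ
  have hlogd : 0 ≤ Real.log d := Real.log_natCast_nonneg d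
  have hℓe : ℓ = Real.log d + Real.log (T + 1 : ℕ) := Real.log_mul hd0.ne' hT0.ne'
  have hℓ0 : 0 ≤ ℓ := by
    rw [hℓe]; exact add_nonneg hlogd (Real.log_natCast_nonneg _)
  have h1 : ∀ n ∈ Finset.range (T + 1),
      Real.sqrt ((4 * Real.log n + 2 * Real.log d) / n)
        ≤ 2 * Real.sqrt ℓ * (1 / Real.sqrt n) := by
    intro n hn
    rcases Nat.eq_zero_or_pos n with rfl | hn0
    · simp
    · have hlog : Real.log n ≤ Real.log (T + 1 : ℕ) :=
        Real.log_le_log (by exact_mod_cast hn0) (by exact_mod_cast (Finset.mem_range.1 hn).le)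
      have h4 : Real.sqrt (4 * Real.log n + 2 * Real.log d) ≤ 2 * Real.sqrt ℓ := by
        rw [show 2 * Real.sqrt ℓ = Real.sqrt (2 ^ 2 * ℓ) by
          rw [Real.sqrt_mul (by positivity), Real.sqrt_sq (by norm_num)]]
        exact Real.sqrt_le_sqrt (by linarith)
      rw [Real.sqrt_div' _ (Nat.cast_nonneg n), div_eq_mul_one_div]
      gcongr
  refine (Finset.sum_le_sum h1).trans ?_
  rw [← Finset.mul_sum]
  have h2 : ∑ n ∈ Finset.range (T + 1), 1 / Real.sqrt n ≤ 2 * Real.sqrt (T + 1 : ℕ) :=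
    (sum_inv_sqrt_le T).trans (by gcongr; exact Nat.le_succ T)
  rw [Real.sqrt_mul hT0.le]
  have h3 := mul_le_mul_of_nonneg_left h2 (show 0 ≤ 2 * Real.sqrt ℓ by positivity)
  linarith

/-- Total weight of the rounds in which the concentration of the noise or of the Gram matrix
may fail. -/
lemma sum_failure_le {d : ℕ} (hd : 1 ≤ d) {C : ℝ} (hC0 : 0 < C) (hC : C ≤ 1 / 2) (T : ℕ) :
    ∑ n ∈ Finset.range T,
        min 1 (2 / (n : ℝ) ^ 2 + 2 * (d : ℝ) ^ 2 * Real.exp (-(8 * C ^ 2 * n)))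
      ≤ 2 * (Real.log (2 * (d : ℝ) ^ 2) + 1) / C ^ 2 := by
  have hd1 : (1 : ℝ) ≤ d := by exact_mod_cast hd
  have h2d : (1 : ℝ) ≤ 2 * (d : ℝ) ^ 2 := by nlinarith
  set L := Real.log (2 * (d : ℝ) ^ 2) with hL
  have hL0 : 0 ≤ L := Real.log_nonneg h2d
  have h1 : ∀ n ∈ Finset.range T,
      min 1 (2 / (n : ℝ) ^ 2 + 2 * (d : ℝ) ^ 2 * Real.exp (-(8 * C ^ 2 * n)))
        ≤ 2 / (n : ℝ) ^ 2 + min 1 (Real.exp (L - 8 * C ^ 2 * n)) := by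
    intro n _
    have he : 2 * (d : ℝ) ^ 2 * Real.exp (-(8 * C ^ 2 * n)) = Real.exp (L - 8 * C ^ 2 * n) := by
      rw [sub_eq_add_neg, Real.exp_add, hL, Real.exp_log (by linarith)]
    have h2 : (0 : ℝ) ≤ 2 / (n : ℝ) ^ 2 := by positivity
    rw [he, ← min_add_add_left]
    exact min_le_min (by linarith) le_rfl
  refine (Finset.sum_le_sum h1).trans ?_
  rw [Finset.sum_add_distrib]
  have h3 := sum_inv_sq_le T
  have h4 := sum_min_one_exp_le hL0 (show 0 < 8 * C ^ 2 by positivity) T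
  have h5 : (L + 1) / (8 * C ^ 2) = (L + 1) / C ^ 2 / 8 := by field_simp
  have h6 : 4 ≤ (L + 1) / C ^ 2 := by
    rw [le_div_iff₀ (by positivity)]
    nlinarith
  rw [h5] at h4
  have h7 : 2 * (L + 1) / C ^ 2 = 2 * ((L + 1) / C ^ 2) := by ring
  rw [h7]
  linarith

lemma sum_Icc_one_eq_sum_range {M : Type*} [AddCommMonoid M] (f : ℕ → M) (n : ℕ) :
    ∑ s ∈ Finset.Icc 1 n, f s = ∑ s ∈ Finset.range n, f (s + 1) := by
  induction n with
  | zero => simp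
  | succ n ih => rw [Finset.sum_Icc_succ_top (by omega), ih, Finset.sum_range_succ]

end Sums

/-! ### The regret of one round -/

section Regret

variable {Ω : Type*} {mΩ : MeasurableSpace Ω} {P : Measure Ω} {d : ℕ}
  {F : Filtration ℕ mΩ} {p : Context 2 d → ℝ} {σ : ℝ} {X : ℕ → Ω → Context 2 d}
  {c : ℕ → Ω → Fin 2} {ε : ℕ → Fin 2 → Ω → ℝ} {βhat : ℕ → Ω → Feature d} {xmax : ℝ}
  {link m : ℝ → ℝ} {βstar : Feature d} {κ0 κ1 b : ℝ}

lemma inner_le_inner_greedyArm (x : Context 2 d) (β : Feature d) (k i : Fin 2) :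
    (inner ℝ (x i) β : ℝ) ≤ inner ℝ (x (greedyArm x β k)) β := by
  unfold greedyArm
  split_ifs with h1 h2
  · fin_cases i
    · exact le_rfl
    · exact h1.le
  · fin_cases i
    · exact h2.le
    · exact le_rfl
  · have h : (inner ℝ (x 0) β : ℝ) = inner ℝ (x 1) β := le_antisymm (not_lt.1 h1) (not_lt.1 h2)
    fin_cases i <;> fin_cases k <;> simp [h]

lemma sub_le_mul_of_deriv_le (hlink : Differentiable ℝ link) (hκ0 : ∀ z, 0 ≤ deriv link z)
    (hκ1 : ∀ z, deriv link z ≤ κ1) {u v r : ℝ} (hr : 0 ≤ r) (huv : u - v ≤ r) :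
    link u - link v ≤ κ1 * r := by
  have hκ : 0 ≤ κ1 := (hκ0 0).trans (hκ1 0)
  rcases le_total v u with h | h
  · exact (image_sub_le_mul_sub_of_deriv_le hlink hκ1 h).trans (by gcongr)
  · have := monotone_of_deriv_nonneg hlink hκ0 h
    have h2 := mul_nonneg hκ hr
    linarith

lemma exists_instantRegret_eq (a : ℕ → Ω → Fin 2) (t : ℕ) (ω : Ω) :
    ∃ i, instantRegret link βstar X a t ω
      = link (inner ℝ (X t ω i) βstar) - link (inner ℝ (X t ω (a t ω)) βstar) := by
  obtain ⟨i, hi⟩ := exists_eq_ciSup_of_finite (f := fun i => link (inner ℝ (X t ω i) βstar))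
  exact ⟨i, by rw [instantRegret, ← hi]⟩

lemma instantRegret_nonneg (a : ℕ → Ω → Fin 2) (t : ℕ) (ω : Ω) :
    0 ≤ instantRegret link βstar X a t ω :=
  sub_nonneg.2 (le_ciSup (f := fun i => link (inner ℝ (X t ω i) βstar))
    (Set.finite_range _).bddAbove (a t ω))

lemma instantRegret_le (hlink : Differentiable ℝ link) (hκ0 : ∀ z, 0 ≤ deriv link z)
    (hκ1 : ∀ z, deriv link z ≤ κ1) (hβ : ‖βstar‖ ≤ b) (hb : 0 ≤ b) (a : ℕ → Ω → Fin 2) {t : ℕ}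
    {ω : Ω} (hX : ∀ i, ‖X t ω i‖ ≤ xmax) :
    instantRegret link βstar X a t ω ≤ κ1 * (2 * xmax * b) := by
  obtain ⟨i, hi⟩ := exists_instantRegret_eq (link := link) (βstar := βstar) (X := X) a t ω
  have hx0 : 0 ≤ xmax := (norm_nonneg _).trans (hX 0)
  have h : ∀ i, |inner ℝ (X t ω i) βstar| ≤ xmax * b := fun i =>
    (abs_real_inner_le_norm _ _).trans (mul_le_mul (hX i) hβ (norm_nonneg _) hx0)
  rw [hi]
  refine sub_le_mul_of_deriv_le hlink hκ0 hκ1 (by positivity) ?_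
  have h1 := (abs_le.1 (h i)).2
  have h2 := (abs_le.1 (h (a t ω))).1
  linarith

/-- The greedy arm loses at most the error of the estimate, as it is optimal for the
estimate. -/
lemma instantRegret_pulledArm_le (hlink : Differentiable ℝ link) (hκ0 : ∀ z, 0 ≤ deriv link z)
    (hκ1 : ∀ z, deriv link z ≤ κ1) {t : ℕ} {ω : Ω} (hX : ∀ i, ‖X t ω i‖ ≤ xmax) {r : ℝ}
    (hr : ‖βhat t ω - βstar‖ ≤ r) :
    instantRegret link βstar X (pulledArm X c βhat) t ω ≤ κ1 * (2 * xmax * r) := by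
  obtain ⟨i, hi⟩ := exists_instantRegret_eq (link := link) (βstar := βstar) (X := X)
    (pulledArm X c βhat) t ω
  have hx0 : 0 ≤ xmax := (norm_nonneg _).trans (hX 0)
  have hr0 : 0 ≤ r := (norm_nonneg _).trans hr
  have h : ∀ i, |inner ℝ (X t ω i) (βhat t ω - βstar)| ≤ xmax * r := fun i =>
    (abs_real_inner_le_norm _ _).trans (mul_le_mul (hX i) hr (norm_nonneg _) hx0)
  rw [hi]
  refine sub_le_mul_of_deriv_le hlink hκ0 hκ1 (by positivity) ?_
  have h0 : (inner ℝ (X t ω i) (βhat t ω) : ℝ)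
      ≤ inner ℝ (X t ω (pulledArm X c βhat t ω)) (βhat t ω) :=
    inner_le_inner_greedyArm (X t ω) (βhat t ω) (c t ω) i
  have h1 := (abs_le.1 (h i)).1
  have h2 := (abs_le.1 (h (pulledArm X c βhat t ω))).2
  rw [inner_sub_right] at h1 h2
  linarith

lemma measurable_instantRegret (hlink : Differentiable ℝ link) {a : ℕ → Ω → Fin 2} {t : ℕ}
    (hX : Measurable (X t)) (ha : Measurable (a t)) :
    Measurable (instantRegret link βstar X a t) := by
  have hm : ∀ i, Measurable fun ω => link (inner ℝ (X t ω i) βstar) := fun i =>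
    hlink.continuous.measurable.comp
      ((show Measurable fun x : Context 2 d => (inner ℝ (x i) βstar : ℝ) by fun_prop).comp hX)
  have h2 := measurable_apply_fin (f := fun ω i => link (inner ℝ (X t ω i) βstar)) hm ha
  exact (Measurable.iSup hm).sub h2

lemma integrable_instantRegret [IsFiniteMeasure P] (hlink : Differentiable ℝ link)
    (hκ0 : ∀ z, 0 ≤ deriv link z) (hκ1 : ∀ z, deriv link z ≤ κ1) (hβ : ‖βstar‖ ≤ b) (hb : 0 ≤ b)
    {a : ℕ → Ω → Fin 2} {t : ℕ} (hXm : Measurable (X t)) (ha : Measurable (a t))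
    (hX : ∀ᵐ ω ∂P, ∀ i, ‖X t ω i‖ ≤ xmax) :
    Integrable (instantRegret link βstar X a t) P := by
  refine Integrable.of_bound (measurable_instantRegret hlink hXm ha).aestronglyMeasurable
    (κ1 * (2 * xmax * b)) ?_
  filter_upwards [hX] with ω hω
  rw [Real.norm_of_nonneg (instantRegret_nonneg a t ω)]
  exact instantRegret_le hlink hκ0 hκ1 hβ hb a hω

/-- Bound on an expectation by a good value, and a worse one on an exceptional event. -/
lemma integral_le_add_mul_measureReal [IsProbabilityMeasure P] {f : Ω → ℝ} (hf : Integrable f P)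
    {A M : ℝ} (hA : 0 ≤ A) {s : Set Ω} (hs : MeasurableSet s) (hM : ∀ᵐ ω ∂P, f ω ≤ M)
    (hgood : ∀ᵐ ω ∂P, ω ∉ s → f ω ≤ A) : ∫ ω, f ω ∂P ≤ A + M * P.real s := by
  have hint : Integrable (fun ω => A + s.indicator (fun _ => M) ω) P :=
    (integrable_const A).add ((integrable_const M).indicator hs)
  have h1 : ∫ ω, f ω ∂P ≤ ∫ ω, (A + s.indicator (fun _ => M) ω) ∂P := by
    refine integral_mono_ae hf hint ?_
    filter_upwards [hM, hgood] with ω h1 h2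
    by_cases hω : ω ∈ s
    · simp only [Set.indicator_of_mem hω]; linarith
    · simpa [Set.indicator_of_notMem hω] using h2 hω
  refine h1.trans (le_of_eq ?_)
  rw [integral_add (integrable_const A) ((integrable_const M).indicator hs),
    integral_indicator_const _ hs]
  simp [mul_comm]

end Regret

/-! ### Expected regret -/

section ExpectedRegret

variable {Ω : Type*} {mΩ : MeasurableSpace Ω} {P : Measure Ω} {d : ℕ}
  {F : Filtration ℕ mΩ} {p : Context 2 d → ℝ} {σ : ℝ} {X : ℕ → Ω → Context 2 d}
  {c : ℕ → Ω → Fin 2} {ε : ℕ → Fin 2 → Ω → ℝ} {βhat : ℕ → Ω → Feature d} {xmax : ℝ}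

/-- The event that, after `n` rounds, the noise exceeds the level that the penalty dominates, or
the empirical Gram matrix is far from the average of its conditional means. -/
def failureEvent (p : Context 2 d → ℝ) (X : ℕ → Ω → Context 2 d) (c : ℕ → Ω → Fin 2)
    (ε : ℕ → Fin 2 → Ω → ℝ) (βhat : ℕ → Ω → Feature d) (lam δ : ℝ) (n : ℕ) : Set Ω :=
  (⋃ j, {ω | n * (lam / 2) ≤ |∑ s ∈ Finset.range n,
        ε (s + 1) (pulledArm X c βhat (s + 1) ω) ω
          * X (s + 1) ω (pulledArm X c βhat (s + 1) ω) j|}) ∪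
  ⋃ i, ⋃ j, {ω | n * δ ≤ |∑ s ∈ Finset.range n,
        (X (s + 1) ω (pulledArm X c βhat (s + 1) ω) i
          * X (s + 1) ω (pulledArm X c βhat (s + 1) ω) j
          - greedyMoment p (fun x => x i * x j) (βhat (s + 1) ω))|}

lemma IsEnvironment.measurableSet_failureEvent [IsProbabilityMeasure P]
    (henv : IsEnvironment P F p σ X c ε) (hβ : ∀ t, Measurable[F t] (βhat (t + 1)))
    (lam δ : ℝ) (n : ℕ) : MeasurableSet (failureEvent p X c ε βhat lam δ n) := by
  have := henv.isProbabilityMeasure_contextLaw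
  have hXm : ∀ s, Measurable (X (s + 1)) := fun s =>
    (henv.measurable_context s).mono (F.le _) le_rfl
  have hcm : ∀ s, Measurable (c (s + 1)) := fun s => (henv.measurable_coin s).mono (F.le _) le_rfl
  have hβm : ∀ s, Measurable (βhat (s + 1)) := fun s => (hβ s).mono (F.le _) le_rfl
  have hεm : ∀ s, Measurable fun ω => ε (s + 1) (pulledArm X c βhat (s + 1) ω) ω := fun s =>
    measurable_apply_fin (f := fun ω i => ε (s + 1) i ω)
      (fun i => (henv.measurable_noise s i).mono (F.le _) le_rfl)
      (measurable_pulledArm (hXm s) (hcm s) (hβm s))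
  have hfm : ∀ s j, Measurable fun ω => X (s + 1) ω (pulledArm X c βhat (s + 1) ω) j :=
    fun s j => (show Measurable fun x : Feature d => x j by fun_prop).comp
      (measurable_pulledFeature (hXm s) (hcm s) (hβm s))
  have hmm : ∀ s i j, Measurable fun ω =>
      greedyMoment p (fun x => x i * x j) (βhat (s + 1) ω) := fun s i j =>
    (measurable_greedyMoment (by fun_prop)).comp (hβm s)
  refine MeasurableSet.union (MeasurableSet.iUnion fun j => ?_)
    (MeasurableSet.iUnion fun i => MeasurableSet.iUnion fun j => ?_)
  · exact measurableSet_le measurable_const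
      (Finset.measurable_sum _ fun s _ => (hεm s).mul (hfm s j)).abs
  · exact measurableSet_le measurable_const
      (Finset.measurable_sum _ fun s _ => ((hfm s i).mul (hfm s j)).sub (hmm s i j)).abs

lemma IsEnvironment.measureReal_failureEvent_le [IsProbabilityMeasure P]
    (henv : IsEnvironment P F p σ X c ε) (hσ : 0 < σ) (hd : 1 ≤ d)
    (hX : ∀ᵐ x ∂contextLaw p, ∀ i, ‖x i‖ ≤ xmax) (hxmax : 0 < xmax)
    (hβ : ∀ t, Measurable[F t] (βhat (t + 1))) {n : ℕ} (hn : 1 ≤ n) {C : ℝ} (hC : 0 ≤ C) :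
    P.real (failureEvent p X c ε βhat (penalty (2 * σ * xmax) d n) (8 * C * xmax ^ 2) n)
      ≤ 2 / (n : ℝ) ^ 2 + 2 * (d : ℝ) ^ 2 * Real.exp (-(8 * C ^ 2 * n)) := by
  have hn0 : (0 : ℝ) < n := by exact_mod_cast hn
  have hd0 : (0 : ℝ) < d := by exact_mod_cast hd
  refine ENNReal.toReal_le_of_le_ofReal (by positivity) ?_
  refine (measure_union_le _ _).trans ?_
  rw [ENNReal.ofReal_add (by positivity) (by positivity)]
  refine add_le_add ?_ ?_
  · refine (measure_iUnion_fintype_le _ _).trans ((Finset.sum_le_sum fun j _ =>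
      henv.measure_noise_le hσ hd hX hxmax hβ hn j).trans (le_of_eq ?_))
    rw [← ENNReal.ofReal_sum_of_nonneg fun _ _ => by positivity]
    congr 1
    rw [Finset.sum_const, Finset.card_univ, Fintype.card_fin, nsmul_eq_mul]
    field_simp
  · refine (measure_iUnion_fintype_le _ _).trans ((Finset.sum_le_sum fun i _ =>
      (measure_iUnion_fintype_le _ _).trans (Finset.sum_le_sum fun j _ =>
        henv.measure_gram_le hX hxmax hβ hn hC i j)).trans (le_of_eq ?_))
    simp_rw [← ENNReal.ofReal_sum_of_nonneg (s := (Finset.univ : Finset (Fin d)))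
      (f := fun _ => 2 * Real.exp (-(8 * C ^ 2 * n))) fun _ _ => by positivity]
    rw [← ENNReal.ofReal_sum_of_nonneg fun _ _ => Finset.sum_nonneg fun _ _ => by positivity]
    congr 1
    simp only [Finset.sum_const, Finset.card_univ, Fintype.card_fin, nsmul_eq_mul]
    ring

variable {link m : ℝ → ℝ} {βstar : Feature d} {κ0 κ1 b : ℝ}

/-- Expected regret of round `n + 1`: the error of the Lasso estimate computed from `n` rounds,
plus the largest possible regret weighted by the probability that concentration fails. The
minimum with `1` makes the bound trivial for `n ≤ 1`. -/
lemma IsSALassoBandit.integral_instantRegret_le [IsProbabilityMeasure P] (hd : 1 ≤ d)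
    (hp : Measurable p) (hp0 : ∀ x, 0 ≤ p x) (hσ : 0 < σ)
    (henv : IsEnvironment P F p σ X c ε) (hxmax : 0 < xmax) (hb : 0 < b)
    (hX : ∀ᵐ x ∂contextLaw p, ∀ i, ‖x i‖ ≤ xmax) (hβ : ‖βstar‖ ≤ b) (hκ0 : 0 < κ0)
    (hlink : Differentiable ℝ link) (hκ : ∀ z, κ0 ≤ deriv link z ∧ deriv link z ≤ κ1)
    (hm : ∀ z, HasDerivAt m (link z) z) {ν : ℝ} (hν : RelaxedSymmetry p ν)
    {φ1 : ℝ} (hφ1 : 0 < φ1) (hRE : RECondition (gram (contextLaw p)) (activeSet βstar) φ1)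
    (halg : IsSALassoBandit P F link m (2 * σ * xmax) βstar X c ε βhat) {C : ℝ} (hC0 : 0 ≤ C)
    (hC : 256 * (activeSet βstar).card * ν * xmax ^ 2 * C ≤ φ1 ^ 2) (n : ℕ) :
    ∫ ω, instantRegret link βstar X (pulledArm X c βhat) (n + 1) ω ∂P
      ≤ κ1 * (2 * xmax * (3 * penalty (2 * σ * xmax) d n * Real.sqrt (activeSet βstar).card
          / (κ0 * (φ1 ^ 2 / ν))))
        + κ1 * (2 * xmax * b)
          * min 1 (2 / (n : ℝ) ^ 2 + 2 * (d : ℝ) ^ 2 * Real.exp (-(8 * C ^ 2 * n))) := by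
  have := henv.isProbabilityMeasure_contextLaw
  have hν1 : 1 ≤ ν := one_le_of_relaxedSymmetry hp hp0 hν
  have hκ1 : 0 < κ1 := hκ0.trans_le ((hκ 0).1.trans (hκ 0).2)
  have hd1 : (1 : ℝ) ≤ d := by exact_mod_cast hd
  have hlogd : 0 ≤ Real.log d := Real.log_natCast_nonneg d
  have hlogn : 0 ≤ Real.log n := Real.log_natCast_nonneg n
  have hpen : 0 ≤ penalty (2 * σ * xmax) d n := by unfold penalty; positivity
  have hXω := henv.ae_norm_le hX
  have hk0 : ∀ z, 0 ≤ deriv link z := fun z => hκ0.le.trans (hκ z).1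
  have hk1 : ∀ z, deriv link z ≤ κ1 := fun z => (hκ z).2
  have hint : Integrable (instantRegret link βstar X (pulledArm X c βhat) (n + 1)) P := by
    have hXm := (henv.measurable_context n).mono (F.le _) le_rfl
    exact integrable_instantRegret hlink hk0 hk1 hβ hb.le hXm (measurable_pulledArm hXm
      ((henv.measurable_coin n).mono (F.le _) le_rfl)
      ((halg.nonanticipating n).mono (F.le _) le_rfl)) (hXω n)
  have hM : ∀ᵐ ω ∂P, instantRegret link βstar X (pulledArm X c βhat) (n + 1) ω
      ≤ κ1 * (2 * xmax * b) := by
    filter_upwards [hXω n] with ω hω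
    exact instantRegret_le hlink hk0 hk1 hβ hb.le _ hω
  have hA : 0 ≤ κ1 * (2 * xmax * (3 * penalty (2 * σ * xmax) d n
      * Real.sqrt (activeSet βstar).card / (κ0 * (φ1 ^ 2 / ν)))) := by positivity
  rcases Nat.lt_or_ge n 2 with hn | hn
  · have hmin : min 1 (2 / (n : ℝ) ^ 2 + 2 * (d : ℝ) ^ 2 * Real.exp (-(8 * C ^ 2 * n))) = 1 := by
      refine min_eq_left ?_
      interval_cases n
      · norm_num
        nlinarith
      · have : 0 ≤ 2 * (d : ℝ) ^ 2 * Real.exp (-(8 * C ^ 2 * (1 : ℕ))) := by positivity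
        norm_num at this ⊢
        linarith
    rw [hmin, mul_one]
    have h1 := integral_mono_ae hint (integrable_const (κ1 * (2 * xmax * b))) hM
    simp only [integral_const, probReal_univ, one_smul] at h1
    linarith
  · have hn1 : 1 ≤ n := by omega
    have hn0 : (0 : ℝ) < n := by exact_mod_cast hn1
    have hlam : 0 < penalty (2 * σ * xmax) d n := by
      have : 0 < Real.log n := Real.log_pos (by exact_mod_cast hn)
      unfold penalty
      positivity
    have hprob := henv.measureReal_failureEvent_le hσ hd hX hxmax halg.nonanticipating hn1 hC0
    refine (integral_le_add_mul_measureReal hint hA (henv.measurableSet_failureEvent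
      halg.nonanticipating (penalty (2 * σ * xmax) d n) (8 * C * xmax ^ 2) n) hM ?_).trans ?_
    · filter_upwards [hXω n, halg.lasso n hn1] with ω hω hlasso hnot
      simp only [failureEvent, Set.mem_union, Set.mem_iUnion, not_or, not_exists] at hnot
      refine instantRegret_pulledArm_le hlink hk0 hk1 hω ?_
      refine lasso_error_le hκ0 hlink (fun z => (hκ z).1) hm hn1 hlam
        (e := fun s => ε s (pulledArm X c βhat s ω) ω) hlasso (fun j => ?_)
        (fun s i j => greedyMoment p (fun x => x i * x j) (βhat s ω)) (by positivity)
        (fun v hv s _ => restricted_eigenvalue_greedy hp hp0 hν hX hRE hv _)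
        (δ := 8 * C * xmax ^ 2) (fun i j => ?_) ?_
      · rw [sum_Icc_one_eq_sum_range]
        exact (not_le.1 (hnot.1 j)).le
      · rw [sum_Icc_one_eq_sum_range]
        exact (not_le.1 (hnot.2 i j)).le
      · rw [le_div_iff₀ (by positivity)]
        linarith
    · have h2 : 0 ≤ κ1 * (2 * xmax * b) := by positivity
      have h3 := mul_le_mul_of_nonneg_left (le_min measureReal_le_one hprob) h2
      linarith

end ExpectedRegret

end SparseBandit

open SparseBandit in
theorem theorem2 {Ω : Type*} [mΩ : MeasurableSpace Ω] (P : Measure Ω) [IsProbabilityMeasure P]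
    (d : ℕ) (hd : 1 ≤ d)
    -- the environment
    (F : Filtration ℕ mΩ) (p : SparseBandit.Context 2 d → ℝ) (σ : ℝ)
    (X : ℕ → Ω → SparseBandit.Context 2 d) (c : ℕ → Ω → Fin 2) (ε : ℕ → Fin 2 → Ω → ℝ)
    (hp : Measurable p) (hp0 : ∀ x, 0 ≤ p x) (hσ : 0 < σ)
    (henv : SparseBandit.IsEnvironment P F p σ X c ε)
    -- bounded features and parameter
    (βstar : SparseBandit.Feature d) (xmax b : ℝ) (hxmax : 0 < xmax) (hb : 0 < b)
    (hX : ∀ᵐ x ∂(SparseBandit.contextLaw p), ∀ i, ‖x i‖ ≤ xmax) (hβ : ‖βstar‖ ≤ b)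
    -- link function `link` (the inverse link), with antiderivative `m`
    (link m : ℝ → ℝ) (κ0 κ1 : ℝ) (hκ0 : 0 < κ0)
    (hlink : Differentiable ℝ link) (hκ : ∀ z, κ0 ≤ deriv link z ∧ deriv link z ≤ κ1)
    (hm : ∀ z, HasDerivAt m (link z) z)
    -- relaxed symmetry
    (ν : ℝ) (hν : SparseBandit.RelaxedSymmetry p ν)
    -- restricted eigenvalue condition for the theoretical Gram matrix
    (φ1 : ℝ) (hφ1 : 0 < φ1)
    (hRE : SparseBandit.RECondition (SparseBandit.gram (SparseBandit.contextLaw p))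
      (SparseBandit.activeSet βstar) φ1)
    -- the algorithm, with `λ₀ = 2 σ x_max`
    (βhat : ℕ → Ω → SparseBandit.Feature d)
    (halg : SparseBandit.IsSALassoBandit P F link m (2 * σ * xmax) βstar X c ε βhat)
    -- the sparsity index
    (s0 : ℕ) (hs0 : s0 = (SparseBandit.activeSet βstar).card) :
    (∀ t : ℕ, 1 ≤ t → Integrable
      (SparseBandit.instantRegret link βstar X (SparseBandit.pulledArm X c βhat) t) P) ∧
    (∀ T : ℕ, 1 ≤ T →
      SparseBandit.expectedRegret P link βstar X (SparseBandit.pulledArm X c βhat) T ≤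
        4 * κ1
        + 4 * κ1 * xmax * b * (Real.log (2 * (d : ℝ) ^ 2) + 1)
            / (SparseBandit.C2 φ1 s0 ν xmax) ^ 2
        + 48 * κ1 * ν * σ * xmax ^ 2 * Real.sqrt (s0 * T * Real.log (d * T))
            / (κ0 * φ1 ^ 2)) ∧
    (fun T : ℕ =>
      SparseBandit.expectedRegret P link βstar X (SparseBandit.pulledArm X c βhat) T)
      =O[Filter.atTop] fun T : ℕ => Real.sqrt (s0 * T * Real.log (d * T)) := by
  have := henv.isProbabilityMeasure_contextLaw
  have hν1 : 1 ≤ ν := one_le_of_relaxedSymmetry hp hp0 hν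
  have hκ1 : 0 < κ1 := hκ0.trans_le ((hκ 0).1.trans (hκ 0).2)
  have hd1 : (1 : ℝ) ≤ d := by exact_mod_cast hd
  have hL0 : 0 ≤ Real.log (2 * (d : ℝ) ^ 2) := Real.log_nonneg (by nlinarith)
  have hk0 : ∀ z, 0 ≤ deriv link z := fun z => hκ0.le.trans (hκ z).1
  have hk1 : ∀ z, deriv link z ≤ κ1 := fun z => (hκ z).2
  set C := C2 φ1 s0 ν xmax with hCdef
  set A := 4 * κ1 + 4 * κ1 * xmax * b * (Real.log (2 * (d : ℝ) ^ 2) + 1) / C ^ 2 with hA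
  have hA0 : 0 ≤ A := by positivity
  have hregret0 : ∀ T, 0 ≤ expectedRegret P link βstar X (pulledArm X c βhat) T := fun T =>
    Finset.sum_nonneg fun t _ => integral_nonneg fun ω => instantRegret_nonneg _ t ω
  -- for `βstar = 0` all arms have the same mean; this case is separate because `C = 0` then, by
  -- the junk value of division by zero
  have hzero : s0 = 0 → ∀ T, expectedRegret P link βstar X (pulledArm X c βhat) T = 0 := by
    intro h0 T
    have he : activeSet βstar = ∅ := Finset.card_eq_zero.1 (hs0 ▸ h0)
    have hβ0 : βstar = 0 := by
      ext j
      by_contra hj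
      have : j ∈ activeSet βstar := by simpa [activeSet] using hj
      simp [he] at this
    simp [expectedRegret, instantRegret, hβ0]
  have hbound : ∀ T : ℕ, 1 ≤ T →
      expectedRegret P link βstar X (pulledArm X c βhat) T ≤
        A + 48 * κ1 * ν * σ * xmax ^ 2 * Real.sqrt (s0 * T * Real.log (d * T))
            / (κ0 * φ1 ^ 2) := by
    intro T hT
    rcases Nat.eq_zero_or_pos s0 with h0 | hpos
    · rw [hzero h0]
      positivity
    · have hs0' : (0 : ℝ) < s0 := by exact_mod_cast hpos
      have hC0 : 0 < C := lt_min (by norm_num) (by positivity)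
      have hC1 : C ≤ 1 / 2 := min_le_left _ _
      have hC2 : 256 * (activeSet βstar).card * ν * xmax ^ 2 * C ≤ φ1 ^ 2 := by
        have h1 : C ≤ φ1 ^ 2 / (256 * s0 * ν * xmax ^ 2) := min_le_right _ _
        rw [le_div_iff₀ (by positivity)] at h1
        rw [← hs0]
        linarith
      have hround := halg.integral_instantRegret_le hd hp hp0 hσ henv hxmax hb hX hβ hκ0 hlink
        hκ hm hν hφ1 hRE hC0.le hC2
      rw [expectedRegret, sum_Icc_one_eq_sum_range]
      refine (Finset.sum_le_sum fun n _ => hround n).trans ?_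
      rw [Finset.sum_add_distrib, ← hs0]
      have h1 := mul_le_mul_of_nonneg_left (sum_failure_le hd hC0 hC1 T)
        (show 0 ≤ κ1 * (2 * xmax * b) by positivity)
      have h2 : ∑ n ∈ Finset.range T, κ1 * (2 * xmax * (3 * penalty (2 * σ * xmax) d n
            * Real.sqrt s0 / (κ0 * (φ1 ^ 2 / ν))))
          = 12 * κ1 * ν * σ * xmax ^ 2 * Real.sqrt s0 / (κ0 * φ1 ^ 2)
            * ∑ n ∈ Finset.range T, Real.sqrt ((4 * Real.log n + 2 * Real.log d) / n) := by
        rw [Finset.mul_sum]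
        refine Finset.sum_congr rfl fun n _ => ?_
        rw [penalty]
        field_simp
        ring
      have h3 := mul_le_mul_of_nonneg_left (sum_penalty_rate_le hd hT)
        (show 0 ≤ 12 * κ1 * ν * σ * xmax ^ 2 * Real.sqrt s0 / (κ0 * φ1 ^ 2) by positivity)
      have h4 : 12 * κ1 * ν * σ * xmax ^ 2 * Real.sqrt s0 / (κ0 * φ1 ^ 2)
            * (4 * Real.sqrt (T * Real.log (d * T)))
          = 48 * κ1 * ν * σ * xmax ^ 2 * Real.sqrt (s0 * T * Real.log (d * T))
            / (κ0 * φ1 ^ 2) := by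
        rw [mul_assoc (s0 : ℝ), Real.sqrt_mul hs0'.le]
        ring
      have h5 : κ1 * (2 * xmax * b) * (2 * (Real.log (2 * (d : ℝ) ^ 2) + 1) / C ^ 2)
          = 4 * κ1 * xmax * b * (Real.log (2 * (d : ℝ) ^ 2) + 1) / C ^ 2 := by ring
      rw [h2, ← Finset.mul_sum]
      linarith
  refine ⟨fun t ht => ?_, hbound, ?_⟩
  · obtain ⟨n, rfl⟩ := Nat.exists_eq_add_of_le' ht
    have hXm := (henv.measurable_context n).mono (F.le _) le_rfl
    exact integrable_instantRegret hlink hk0 hk1 hβ hb.le hXm (measurable_pulledArm hXm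
      ((henv.measurable_coin n).mono (F.le _) le_rfl)
      ((halg.nonanticipating n).mono (F.le _) le_rfl)) (henv.ae_norm_le hX n)
  · rcases Nat.eq_zero_or_pos s0 with h0 | hpos
    · simp only [hzero h0]
      exact Asymptotics.isBigO_zero _ _
    · refine Asymptotics.IsBigO.of_bound
        (A + 48 * κ1 * ν * σ * xmax ^ 2 / (κ0 * φ1 ^ 2)) ?_
      filter_upwards [Filter.eventually_ge_atTop 3] with T hT
      have hT3 : (3 : ℝ) ≤ T := by exact_mod_cast hT
      have hs1 : (1 : ℝ) ≤ s0 := by exact_mod_cast hpos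
      have hlog : 1 ≤ Real.log (d * T) := by
        rw [Real.le_log_iff_exp_le (by positivity)]
        have := Real.exp_one_lt_three
        nlinarith
      have hg : 1 ≤ Real.sqrt (s0 * T * Real.log (d * T)) := by
        rw [Real.one_le_sqrt]
        have h1 : 1 ≤ (s0 : ℝ) * T := by nlinarith
        nlinarith
      rw [Real.norm_of_nonneg (hregret0 T), Real.norm_of_nonneg (Real.sqrt_nonneg _)]
      refine (hbound T (by omega)).trans ?_
      have h1 : A ≤ A * Real.sqrt (s0 * T * Real.log (d * T)) := le_mul_of_one_le_right hA0 hg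
      rw [add_mul, mul_div_right_comm]
      linarith
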